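/- All knots are smooth and lie in $S^3$; $G(K)=\pi_1(S^3\setminus K)$ denotes the knot group. An element of $G(K)$ is called a meridian if it is represented by a loop that is freely homotopic in $S^3\setminus K$ to a meridian curve, with either orientation, on the boundary of a tubular neighborhood of $K$. A homomorphism of knot groups is called meridional if it sends a meridian to a meridian. A group $G$ is residually solvable if $\bigcap_{n<\infty}G^{(n)}=\{e\}$, where $G^{(0)}=G$ and $G^{(n+1)}=[G^{(n)},G^{(n)}]$. Let $K$ be a knot in $S^3$, let $\alpha$ be an oriented knot in $S^3$ which is disjoint from $K$ and unknotted in $S^3$, and let $J$ be another (oriented) knot. Denote by $K(\alpha,J)$ the satellite knot obtained as follows: glue the exteriors $E_\alpha$ (containing $K$) and $E_J$ along their boundary tori, identifying a zero-linking longitude and a positively oriented meridian of $\alpha$ with a positively oriented meridian and a zero-linking longitude of $J$, respectively; the resulting 3-manifold is diffeomorphic to $S^3$, and $K(\alpha,J)$ is the image of $K$ under a diffeomorphism onto $S^3$. Let $T$ be a knot whose group $G(T)$ is residually solvable, and suppose that $J$ has Alexander polynomial one. If there is no meridional epimorphism of $G(K)$ onto $G(T)$, then there is no meridional epimorphism of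 $G(K(\alpha,J))$ onto $G(T)$. -/

import Mathlib

open scoped Manifold ContDiff LaurentPolynomial

noncomputable section

namespace KnotTheory

/-! ### Group theory and commutative algebra -/

/-- A group `G` is residually solvable if the intersection `G^(ω)` of its (finite) derived
subgroups is trivial. -/
def IsResiduallySolvable (G : Type*) [Group G] : Prop :=
  ⨅ n : ℕ, derivedSeries G n = ⊥

/-- The order ideal (zeroth Fitting ideal, zeroth elementary ideal) of a finitely generated module:
the ideal generated by the determinants of the square matrices of relations between the members of
a finite generating family.  One generating family would give the same ideal as all of them. -/
def orderIdeal (R M : Type*) [CommRing R] [AddCommGroup M] [Module R M] : Ideal R :=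
  Ideal.span {d | ∃ (n : ℕ) (v : Fin n → M) (A : Matrix (Fin n) (Fin n) R),
    Submodule.span R (Set.range v) = ⊤ ∧ (∀ i, ∑ j, A i j • v j = 0) ∧ d = A.det}

/-- The abelian group `G' / G''`, where `G' = [G, G]` and `G'' = [G', G']`.  The element `m` is
recorded because it gives the module structure. For a knot group and a meridian `m` this is the
first homology of the infinite cyclic cover of the knot complement. -/
def AlexanderModule {G : Type*} [Group G] (_m : G) : Type _ :=
  Additive (Abelianization (commutator G))

instance {G : Type*} [Group G] (m : G) : AddCommGroup (AlexanderModule m) :=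
  inferInstanceAs (AddCommGroup (Additive (Abelianization (commutator G))))

/-- The action of `ℤ` by powers of conjugation by `m`, that is `g ↦ m g m⁻¹`, on `G' / G''`. -/
def AlexanderModule.conj {G : Type*} [Group G] (m : G) :
    Multiplicative ℤ →* AddMonoid.End (AlexanderModule m) where
  toFun k := MonoidHom.toAdditive
    (Abelianization.map (MulAut.conjNormal (H := commutator G) (m ^ k.toAdd)).toMonoidHom)
  map_one' := by
    ext x
    induction x using Additive.rec with | _ x =>
    induction x using QuotientGroup.induction_on with | _ x =>
    exact congrArg Abelianization.of (Subtype.ext (by simp))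
  map_mul' a b := by
    ext x
    induction x using Additive.rec with | _ x =>
    induction x using QuotientGroup.induction_on with | _ x =>
    exact congrArg Abelianization.of (Subtype.ext (by simp [zpow_add]))

/-- `G' / G''` is a module over `ℤ[t, t⁻¹]`, where `t` acts by conjugation by `m`. -/
instance {G : Type*} [Group G] (m : G) : Module ℤ[T;T⁻¹] (AlexanderModule m) :=
  Module.compHom _
    (AddMonoidAlgebra.lift ℤ (AddMonoid.End (AlexanderModule m)) ℤ
      (AlexanderModule.conj m)).toRingHom

/-! ### Curves and fundamental groups -/

/-- The loop `t ↦ d (exp (2πit))` defined by a map `d` from the unit circle. -/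
def circleLoop {X : Type*} [TopologicalSpace X] (d : C(Circle, X)) : Path (d 1) (d 1) where
  toFun t := d (Circle.exp (2 * Real.pi * (t : ℝ)))
  continuous_toFun := by fun_prop
  source' := by simp
  target' := by simp

/-- The element `g` of `π₁(X, x)` is the class of the closed curve `d`, which starts at `x`. -/
def IsClassOf {X : Type*} [TopologicalSpace X] {x : X} (g : FundamentalGroup X x)
    (d : C(Circle, X)) : Prop :=
  ∃ h : d 1 = x, g = FundamentalGroup.fromPath ⟦(circleLoop d).cast h.symm h.symm⟧

/-! ### Knots in the 3-sphere -/

/-- The 3-sphere: the unit sphere of `ℝ⁴`. -/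
abbrev S3 : Type := Metric.sphere (0 : EuclideanSpace ℝ (Fin 4)) 1

instance : Fact (Module.finrank ℝ (EuclideanSpace ℝ (Fin 4)) = 3 + 1) := ⟨by simp⟩

/-- A knot: a smooth embedding of the circle in the 3-sphere. The parametrization orients it; only
the image matters for notions about unoriented knots. -/
structure Knot where
  toFun : Circle → S3
  isSmoothEmbedding : Manifold.IsSmoothEmbedding (𝓡 1) (𝓡 3) ∞ toFun

namespace Knot

/-- The knot as a subset of the 3-sphere. -/
def image (K : Knot) : Set S3 := Set.range K.toFun

/-- The complement `S³ ∖ K`. -/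
abbrev Complement (K : Knot) : Type := ↥(K.imageᶜ)

/-- The knot group `G(K) = π₁(S³ ∖ K, x)`. -/
abbrev group (K : Knot) (x : K.Complement) : Type := FundamentalGroup K.Complement x

/-- `τ` parametrizes an (open) tubular neighbourhood of `K`: it is a diffeomorphism of `S¹ × ℂ` onto
an open subset of `S³` whose restriction to `S¹ × 0` is `K`.  The closed tubular neighbourhood is
the image of `S¹ × D²`, with boundary torus the image of `S¹ × S¹`. -/
structure IsTube (K : Knot) (τ : Circle × ℂ → S3) : Prop where
  core : ∀ z, τ (z, 0) = K.toFun z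
  injective : Function.Injective τ
  isLocalDiffeomorph : IsLocalDiffeomorph ((𝓡 1).prod 𝓘(ℝ, ℂ)) (𝓡 3) ∞ τ

/-- The element `g` of `G(K)` is a meridian: it is the class of a curve that is freely homotopic in
`S³ ∖ K` to a meridian curve `w ↦ τ (1, w)`, `|w| = 1`, on the boundary of a tubular neighbourhood
of `K`. Both orientations of the meridian curve are allowed, since `(z, w) ↦ τ (z, w̄)` parametrizes
the same tubular neighbourhood. -/
def IsMeridian (K : Knot) {x : K.Complement} (g : K.group x) : Prop :=
  ∃ τ : Circle × ℂ → S3, K.IsTube τ ∧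
    ∃ c d : C(Circle, K.Complement),
      (∀ w : Circle, (c w : S3) = τ (1, (w : ℂ))) ∧ d.Homotopic c ∧ IsClassOf g d

/-- The 4 by 4 determinant with rows `τ`, `∂τ/∂θ`, `∂τ/∂u`, `∂τ/∂v` at `(z, w)`, where `θ` is the
angle of `z` and `w = u + iv`. It is positive if `τ` preserves orientation there, where `S³` is
oriented as the boundary of the unit ball. -/
def orientationDet (τ : Circle × ℂ → S3) (z : Circle) (w : ℂ) : ℝ :=
  Matrix.det (Matrix.of fun i j : Fin 4 =>
    (![(τ (z, w) : EuclideanSpace ℝ (Fin 4)),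
      deriv (fun s : ℝ => (τ (z * Circle.exp s, w) : EuclideanSpace ℝ (Fin 4))) 0,
      deriv (fun s : ℝ => (τ (z, w + s) : EuclideanSpace ℝ (Fin 4))) 0,
      deriv (fun s : ℝ => (τ (z, w + s * Complex.I) : EuclideanSpace ℝ (Fin 4))) 0] i) j)

/-- `τ` parametrizes a tubular neighbourhood of the oriented knot `K` in such a way that
`w ↦ τ (1, w)`, `|w| = 1`, is a positively oriented meridian (`τ` preserves orientation) and
`z ↦ τ (z, 1)` is the zero-linking longitude (it is parallel to `K`, and null-homologous in
`S³ ∖ K`: its class in `π₁` is in the commutator subgroup). -/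
structure IsFramedTube (K : Knot) (τ : Circle × ℂ → S3) : Prop extends K.IsTube τ where
  orientation : ∀ z w, 0 < orientationDet τ z w
  longitude : ∃ c : C(Circle, K.Complement), (∀ z : Circle, (c z : S3) = τ (z, 1)) ∧
    (FundamentalGroup.fromPath ⟦circleLoop c⟧ : K.group (c 1)) ∈ commutator (K.group (c 1))

/-- The knot is unknotted: a diffeomorphism of `S³` takes it to a great circle. -/
def IsUnknotted (K : Knot) : Prop :=
  ∃ Φ : S3 ≃ₘ⟮𝓡 3, 𝓡 3⟯ S3,
    Φ '' K.image = {x : S3 | (x : EuclideanSpace ℝ (Fin 4)) 2 = 0 ∧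
      (x : EuclideanSpace ℝ (Fin 4)) 3 = 0}

/-- `Δ` is an Alexander polynomial of `K`: it generates the order ideal of the Alexander module
(so it is determined up to units, and up to `t ↦ t⁻¹`, which depends on the meridian). -/
def IsAlexanderPolynomial (K : Knot) (x : K.Complement) (Δ : ℤ[T;T⁻¹]) : Prop :=
  ∃ m : K.group x, K.IsMeridian m ∧
    orderIdeal ℤ[T;T⁻¹] (AlexanderModule m) = Ideal.span {Δ}

/-- A homomorphism of knot groups is meridional if it sends a meridian to a meridian. -/
def IsMeridional (K K' : Knot) {x : K.Complement} {y : K'.Complement}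
    (f : K.group x →* K'.group y) : Prop :=
  ∃ m : K.group x, K.IsMeridian m ∧ K'.IsMeridian (f m)

/-- There is a meridional epimorphism of `G(K)`, based at `x`, onto `G(K')`, based at `y`. -/
def HasMeridionalEpi (K K' : Knot) (x : K.Complement) (y : K'.Complement) : Prop :=
  ∃ f : K.group x →* K'.group y, Function.Surjective f ∧ IsMeridional K K' f

/-- `L` is a satellite knot `K(α, J)`.

Let `τ` and `σ` be framed tubes of `α` and `J`, with `K` outside the tube of `α`, and let
`E_α`, `E_J` be the exteriors `S³ ∖ τ (S¹ × int D²)`, `S³ ∖ σ (S¹ × int D²)`.  Their boundary tori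
are glued by `τ (z, w) ∼ σ (w, z)`, `|z| = |w| = 1`, which takes the zero-linking longitude
`z ↦ τ (z, 1)` of `α` to the positive meridian of `J`, and the positive meridian `w ↦ τ (1, w)` of
`α` to the zero-linking longitude of `J`.  To have the smooth structure of the result at hand, the
gluing is done along the collars of the tori given by the tubes: `S³ ∖ α` and `S³ ∖ J` are
glued along the open sets of the points `τ (z, r w)` and `σ (w, r⁻¹ z)`, `r > 0`.
The maps `ι` and `κ` are the two components of a diffeomorphism of the glued manifold onto `S³`,
and `L` is the image of `K` under it. -/
def IsSatellite (K α J L : Knot) : Prop :=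
  ∃ τ σ : Circle × ℂ → S3, α.IsFramedTube τ ∧ J.IsFramedTube σ ∧
    Disjoint K.image (Set.range τ) ∧
    ∃ ι κ : S3 → S3,
      IsLocalDiffeomorphOn (𝓡 3) (𝓡 3) ∞ ι α.imageᶜ ∧
      IsLocalDiffeomorphOn (𝓡 3) (𝓡 3) ∞ κ J.imageᶜ ∧
      Set.InjOn ι α.imageᶜ ∧ Set.InjOn κ J.imageᶜ ∧
      ι '' α.imageᶜ ∪ κ '' J.imageᶜ = Set.univ ∧
      (∀ p ∈ α.imageᶜ, ∀ q ∈ J.imageᶜ, ι p = κ q ↔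
        ∃ (z w : Circle) (r : ℝ), 0 < r ∧
          p = τ (z, (r : ℂ) * (w : ℂ)) ∧ q = σ (w, ((r⁻¹ : ℝ) : ℂ) * (z : ℂ))) ∧
      L.image = ι '' K.image

end Knot

end KnotTheory

end

/-! Given a meridional epimorphism of G(L) onto G(T), one constructs such an epimorphism of G(K).
The complement of L is the union of copies of S³ ∖ (K ∪ α) and S³ ∖ J which overlap in a punctured
tube of α, where the meridian of α is the longitude of J and the longitude of α is the meridian of
J. Alexander polynomial one means that the Alexander module of J vanishes, so G(J)' is perfect; its
image lies in every derived subgroup of G(T) and is therefore trivial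
(`map_eq_one_of_mem_commutator`). The longitude of J lies in G(J)', so the restriction to S³ ∖ (K ∪
α) kills the meridian of α and extends over α to S³ ∖ K (`Transport.exists_extension_of_meridian`).

The extension is onto: G(J) is normally generated by its meridian because S³ is simply connected
(`IsTube.eq_top_of_meridian_mem`), and its image is abelian, so that image already comes from the
longitude of α. Since the two pieces generate G(L) (`map_mem_of_open_cover`), the piece S³ ∖ (K ∪ α)
alone reaches all of G(T). The extension is meridional: a thinned tube of L pulls back to a tube of
K (`IsTube.exists_pullback`), so the two homomorphisms agree on meridian curves up to conjugacy, and
conjugates of meridians are meridians.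

Base points are kept out of the way by replacing homomorphisms with transports, that is, functors
from the fundamental groupoid to a group, written as functions on paths. Van Kampen's theorem is
then the gluing statement `exists_isTransportOn_univ`. -/

noncomputable section

namespace KnotTheory
open unitInterval Set

/-! ### Parallel transport along paths -/

section Transport

variable {X Y G : Type*} [TopologicalSpace X] [TopologicalSpace Y] [Group G]

/-- The affine segment from `a` to `b` in the unit square. -/
def seg (a b : I × I) : C(I, I × I) :=
  ⟨fun r => (Icc.convexComb a.1 b.1 r, Icc.convexComb a.2 b.2 r),
    (Icc.continuous_convexComb _ _).prodMk (Icc.continuous_convexComb _ _)⟩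

@[simp] lemma seg_apply (a b : I × I) (r : I) :
    seg a b r = (Icc.convexComb a.1 b.1 r, Icc.convexComb a.2 b.2 r) := rfl

/-- The restriction of a path to the interval from `s` to `t`, reparametrized. -/
def cut (γ : C(I, X)) (s t : I) : C(I, X) :=
  γ.comp ⟨Icc.convexComb s t, Icc.continuous_convexComb _ _⟩

@[simp] lemma cut_apply (γ : C(I, X)) (s t r : I) : cut γ s t r = γ (Icc.convexComb s t r) := rfl

lemma convexComb_convexComb (s s' x y r : I) :
    Icc.convexComb s s' (Icc.convexComb x y r) =
      Icc.convexComb (Icc.convexComb s s' x) (Icc.convexComb s s' y) r := by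
  ext; simp only [Icc.coe_convexComb]; ring

lemma convexComb_mem_Icc {a b : I} (hab : a ≤ b) (s : I) : Icc.convexComb a b s ∈ Icc a b :=
  ⟨Icc.le_convexComb hab s, Icc.convexComb_le hab s⟩

lemma exists_convexComb_eq {s s' x : I} (hx : x ∈ Icc s s') : ∃ y, Icc.convexComb s s' y = x :=
  ⟨_, (Icc.eq_convexComb hx.1 hx.2).symm⟩

@[simp] lemma cut_zero_one (γ : C(I, X)) : cut γ 0 1 = γ := by
  ext r; simp

@[simp] lemma cut_self (γ : C(I, X)) (s : I) : cut γ s s = .const I (γ s) := by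
  ext r; simp

/-- `v` assigns group elements to paths so that, for paths inside `U`, the values multiply along
the sides of singular triangles. -/
def IsTransportOn (v : C(I, X) → G) (U : Set X) : Prop :=
  ∀ H : C(I × I, X), (∀ p, H p ∈ U) → ∀ a b c,
    v (H.comp (seg b c)) * v (H.comp (seg a b)) = v (H.comp (seg a c))

namespace IsTransportOn

variable {v : C(I, X) → G} {U : Set X}

/-- An affine map of the whole square onto the rectangle takes segments to segments, so it is enough
that the rectangle, rather than the square, maps into `U`. -/
lemma rect (hv : IsTransportOn v U) (H : C(I × I, X)) {s s' t t' : I}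
    (hH : ∀ p ∈ Icc s s' ×ˢ Icc t t', H p ∈ U) (hs : s ≤ s') (ht : t ≤ t') {a b c : I × I}
    (ha : a ∈ Icc s s' ×ˢ Icc t t') (hb : b ∈ Icc s s' ×ˢ Icc t t')
    (hc : c ∈ Icc s s' ×ˢ Icc t t') :
    v (H.comp (seg b c)) * v (H.comp (seg a b)) = v (H.comp (seg a c)) := by
  obtain ⟨a1, ha1⟩ := exists_convexComb_eq ha.1
  obtain ⟨a2, ha2⟩ := exists_convexComb_eq ha.2
  obtain ⟨b1, hb1⟩ := exists_convexComb_eq hb.1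
  obtain ⟨b2, hb2⟩ := exists_convexComb_eq hb.2
  obtain ⟨c1, hc1⟩ := exists_convexComb_eq hc.1
  obtain ⟨c2, hc2⟩ := exists_convexComb_eq hc.2
  let ρ : C(I × I, I × I) := ⟨fun p => (Icc.convexComb s s' p.1, Icc.convexComb t t' p.2),
    ((Icc.continuous_convexComb _ _).comp continuous_fst).prodMk
      ((Icc.continuous_convexComb _ _).comp continuous_snd)⟩
  have key : ∀ x y : I × I, (H.comp ρ).comp (seg x y) = H.comp (seg (ρ x) (ρ y)) := by
    intro x y; ext r; simp [ρ, convexComb_convexComb]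
  have := hv (H.comp ρ) (fun p => hH _ ⟨convexComb_mem_Icc hs _, convexComb_mem_Icc ht _⟩)
    (a1, a2) (b1, b2) (c1, c2)
  simpa only [key, ρ, ContinuousMap.coe_mk, ha1, ha2, hb1, hb2, hc1, hc2, Prod.mk.eta] using this

lemma cut_mul_cut (hv : IsTransportOn v U) (γ : C(I, X)) {s t s' : I} (hst : s ≤ t) (hts : t ≤ s')
    (hγ : ∀ r ∈ Icc s s', γ r ∈ U) :
    v (cut γ t s') * v (cut γ s t) = v (cut γ s s') := by
  have := hv.rect (γ.comp ContinuousMap.fst) (s := s) (s' := s') (t := 0) (t' := 0)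
    (fun p hp => hγ _ hp.1) (hst.trans hts) le_rfl (a := (s, 0)) (b := (t, 0)) (c := (s', 0))
    ⟨⟨le_rfl, hst.trans hts⟩, le_rfl, le_rfl⟩ ⟨⟨hst, hts⟩, le_rfl, le_rfl⟩
    ⟨⟨hst.trans hts, le_rfl⟩, le_rfl, le_rfl⟩
  exact this

lemma const (hv : IsTransportOn v U) {x : X} (hx : x ∈ U) : v (.const I x) = 1 := by
  have := hv (.const _ x) (fun _ => hx) 0 0 0
  simpa using this

lemma rect_comm (hv : IsTransportOn v U) (H : C(I × I, X)) {s s' t t' : I}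
    (hs : s ≤ s') (ht : t ≤ t') (hH : ∀ p ∈ Icc s s' ×ˢ Icc t t', H p ∈ U) :
    v (H.comp (seg (s, t') (s', t'))) * v (H.comp (seg (s, t) (s, t'))) =
      v (H.comp (seg (s', t) (s', t'))) * v (H.comp (seg (s, t) (s', t))) := by
  rw [hv.rect H hH hs ht ⟨⟨le_rfl, hs⟩, le_rfl, ht⟩ ⟨⟨le_rfl, hs⟩, ht, le_rfl⟩
      ⟨⟨hs, le_rfl⟩, ht, le_rfl⟩,
    hv.rect H hH hs ht ⟨⟨le_rfl, hs⟩, le_rfl, ht⟩ ⟨⟨hs, le_rfl⟩, le_rfl, ht⟩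
      ⟨⟨hs, le_rfl⟩, ht, le_rfl⟩]

end IsTransportOn

/-! ### Gluing local transports: van Kampen's theorem for groupoids. -/

section VanKampen

variable {ι : Type*} (U : ι → Set X) (v : C(I, X) → G)

/-- `Φ` integrates the transport `v` along `γ`: its increments over the intervals that `γ` maps into
one of the sets `U k` are given by `v`. -/
def IsPotential (γ : C(I, X)) (Φ : I → G) : Prop :=
  ∀ k s s', s ≤ s' → (∀ r ∈ Icc s s', γ r ∈ U k) → Φ s' = v (cut γ s s') * Φ s

variable {U v}

lemma IsPotential.mul_const {γ : C(I, X)} {Φ : I → G} (h : IsPotential U v γ Φ) (g : G) :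
    IsPotential U v γ (fun t => Φ t * g) := by
  intro k s s' hs hr
  simp only [h k s s' hs hr, mul_assoc]

variable (hU : ∀ k, IsOpen (U k)) (hcov : ∀ x, ∃ k, x ∈ U k)
include hU hcov

lemma exists_partition (γ : C(I, X)) : ∃ t : ℕ → I, t 0 = 0 ∧ Monotone t ∧
    (∃ n, t n = 1) ∧ ∀ n, ∃ k, ∀ r ∈ Icc (t n) (t (n + 1)), γ r ∈ U k := by
  obtain ⟨t, h0, hm, ⟨n, hn⟩, h⟩ := exists_monotone_Icc_subset_open_cover_unitInterval
    (c := fun k => γ ⁻¹' U k) (fun k => (hU k).preimage γ.continuous)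
    (fun r _ => mem_iUnion.2 (hcov (γ r)))
  exact ⟨t, h0, hm, ⟨n, hn n le_rfl⟩, fun n => (h n).imp fun k hk r hr => hk hr⟩

lemma IsPotential.eq_one {γ : C(I, X)} {Φ Ψ : I → G} (hΦ : IsPotential U v γ Φ)
    (hΨ : IsPotential U v γ Ψ) (h0 : Φ 0 = Ψ 0) : Φ 1 = Ψ 1 := by
  obtain ⟨t, ht0, hm, ⟨N, hN⟩, h⟩ := exists_partition hU hcov γ
  rw [← hN]
  generalize N = n
  induction n with
  | zero => rw [ht0, h0]
  | succ n ih =>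
    obtain ⟨k, hk⟩ := h n
    rw [hΦ k _ _ (hm n.le_succ) hk, hΨ k _ _ (hm n.le_succ) hk, ih]

variable (hv : ∀ k, IsTransportOn v (U k))
include hv

/-- The potential is continued over one interval of a fine partition at a time; on each new interval
a single member of the cover dictates the increments. -/
lemma exists_isPotential (γ : C(I, X)) : ∃ Φ : I → G, IsPotential U v γ Φ ∧ Φ 0 = 1 := by
  obtain ⟨t, ht0, hm, ⟨N, hN⟩, h⟩ := exists_partition hU hcov γ
  suffices ∀ n, ∃ Φ : I → G, Φ 0 = 1 ∧ ∀ k s s', s ≤ s' → s' ≤ t n →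
      (∀ r ∈ Icc s s', γ r ∈ U k) → Φ s' = v (KnotTheory.cut γ s s') * Φ s by
    obtain ⟨Φ, h0, hΦ⟩ := this N
    exact ⟨Φ, fun k s s' hs hr => hΦ k s s' hs (hN ▸ le_one') hr, h0⟩
  intro n
  induction n with
  | zero =>
    refine ⟨fun _ => 1, rfl, fun k s s' hs hs' hr => ?_⟩
    obtain rfl : s = s' := le_antisymm hs (hs'.trans (ht0 ▸ nonneg'))
    rw [cut_self, (hv k).const (hr s ⟨le_rfl, le_rfl⟩), one_mul]
  | succ n ih =>
    obtain ⟨Φ, h0, hΦ⟩ := ih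
    obtain ⟨k₀, hk₀⟩ := h n
    refine ⟨fun r => if r ≤ t n then Φ r else v (KnotTheory.cut γ (t n) r) * Φ (t n), ?_,
      fun k s s' hs hs' hr => ?_⟩
    · simp only [nonneg', if_true, h0]
    · by_cases h1 : s' ≤ t n
      · simp only [h1, hs.trans h1, if_true]
        exact hΦ k s s' hs h1 hr
      · simp only [h1, if_false]
        push Not at h1
        by_cases h2 : s ≤ t n
        · simp only [h2, if_true]
          rw [hΦ k s (t n) h2 le_rfl fun r hr' => hr r ⟨hr'.1, hr'.2.trans h1.le⟩, ← mul_assoc,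
            (hv k).cut_mul_cut γ h2 h1.le hr]
        · simp only [h2, if_false]
          push Not at h2
          rw [← mul_assoc, (hv k₀).cut_mul_cut γ h2.le hs]
          exact fun r hr' => hk₀ r ⟨hr'.1, hr'.2.trans hs'⟩

open Classical in
/-- A transport defined on the members of an open cover extends to all paths. -/
theorem exists_isTransportOn_univ : ∃ w : C(I, X) → G, IsTransportOn w univ ∧
    ∀ k, ∀ γ : C(I, X), (∀ r, γ r ∈ U k) → w γ = v γ := by
  choose Φ hΦ hΦ0 using exists_isPotential hU hcov hv
  -- Potentials along a path differ by a right factor, so any of them computes the total increment,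
  -- which will be the value of `w`.
  have hval : ∀ (γ : C(I, X)) (Ψ : I → G), IsPotential U v γ Ψ → Ψ 1 = Φ γ 1 * Ψ 0 := by
    intro γ Ψ hΨ
    exact hΨ.eq_one hU hcov ((hΦ γ).mul_const (Ψ 0)) (by simp [hΦ0])
  have hconst : ∀ x, Φ (.const I x) 1 = 1 := by
    intro x
    have := hval (.const I x) (fun _ => 1) fun k s s' _ hr => by
      have : KnotTheory.cut (.const I x) s s' = .const I x := rfl
      rw [this, (hv k).const (x := x) (hr s ⟨le_rfl, by assumption⟩), one_mul]
    simpa using this.symm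
  have hsq : ∀ H : C(I × I, X),
      Φ (H.comp (seg (0, 1) (1, 1))) 1 * Φ (H.comp (seg (0, 0) (0, 1))) 1 =
      Φ (H.comp (seg (1, 0) (1, 1))) 1 * Φ (H.comp (seg (0, 0) (1, 0))) 1 := by
    intro H
    obtain ⟨t, ht0, hm, ⟨N, hN⟩, hrect⟩ :=
      exists_monotone_Icc_subset_open_cover_unitInterval_prod_self
        (c := fun k => H ⁻¹' U k) (fun k => (hU k).preimage H.continuous)
        (fun r _ => mem_iUnion.2 (hcov (H r)))
    replace hN := hN N le_rfl
    have hcutv : ∀ s x y : I, KnotTheory.cut (H.comp (seg (s, 0) (s, 1))) x y =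
        H.comp (seg (s, x) (s, y)) := by
      intro s x y; ext r; simp
    have hcuth : ∀ s x y : I, KnotTheory.cut (H.comp (seg (0, s) (1, s))) x y =
        H.comp (seg (x, s) (y, s)) := by
      intro s x y; ext r; simp
    set χ := Φ (H.comp (seg (0, 0) (1, 0))) with hχ
    have hχp : IsPotential U v _ χ := hΦ _
    -- `Ψ s x` integrates from the corner `(0, 0)` along the side `x = 0` to `(s, 0)`, and then to
    -- `(s, x)`. It remains to see that it has the right increments in `s` too; on grid points this
    -- follows by induction over the small rectangles.
    let Ψ : I → I → G := fun s x => Φ (H.comp (seg (s, 0) (s, 1))) x * χ s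
    have hΨ : ∀ s, IsPotential U v (H.comp (seg (s, 0) (s, 1))) (Ψ s) :=
      fun s => (hΦ _).mul_const _
    have hstep : ∀ n m, Ψ (t (n + 1)) (t m) =
        v (H.comp (seg (t n, t m) (t (n + 1), t m))) * Ψ (t n) (t m) := by
      intro n m
      induction m with
      | zero =>
        obtain ⟨k, hk⟩ := hrect n 0
        have := hχp k (t n) (t (n + 1)) (hm n.le_succ) fun r hr => by
          simpa using hk (show (r, (0 : I)) ∈ _ from ⟨hr, ht0.le, ht0 ▸ hm (Nat.zero_le _)⟩)
        rw [hcuth] at this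
        simp only [Ψ, ht0, hΦ0, one_mul]
        exact this
      | succ m ih =>
        obtain ⟨k, hk⟩ := hrect n m
        have e1 := hΨ (t (n + 1)) k (t m) (t (m + 1)) (hm m.le_succ) fun r hr => by
          simpa using hk (show (t (n + 1), r) ∈ _ from ⟨⟨hm n.le_succ, le_rfl⟩, hr⟩)
        have e2 := hΨ (t n) k (t m) (t (m + 1)) (hm m.le_succ) fun r hr => by
          simpa using hk (show (t n, r) ∈ _ from ⟨⟨le_rfl, hm n.le_succ⟩, hr⟩)
        rw [hcutv] at e1 e2
        have key := (hv k).rect_comm H (hm n.le_succ) (hm m.le_succ) (fun p hp => hk hp)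
        rw [e1, e2, ih]
        exact (mul_assoc _ _ _).symm.trans
          ((congrArg (· * Ψ (t n) (t m)) key.symm).trans (mul_assoc _ _ _))
    set Θ := Φ (H.comp (seg (0, 1) (1, 1)))
    have hΘp : IsPotential U v _ Θ := hΦ _
    have hend : ∀ n, Ψ (t n) 1 = Θ (t n) * Ψ 0 1 := by
      intro n
      induction n with
      | zero => rw [ht0, show Θ 0 = 1 from hΦ0 _, one_mul]
      | succ n ih =>
        -- Since `t N = 1`, the cells with second index `N` are degenerate and cover the side at
        -- height 1.
        obtain ⟨k, hk⟩ := hrect n N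
        have := hΘp k (t n) (t (n + 1)) (hm n.le_succ) fun r hr => by
          simpa using hk (show (r, (1 : I)) ∈ _ from ⟨hr, hN.le, hN ▸ hm N.le_succ⟩)
        rw [hcuth] at this
        rw [this, mul_assoc, ← ih]
        have h2 := hstep n N
        rwa [hN] at h2
    have := hend N
    rw [hN] at this
    simp only [Ψ, hχ, hΦ0, mul_one] at this
    exact this.symm
  refine ⟨fun γ => Φ γ 1, fun H _ a b c => ?_, fun k γ hγ => ?_⟩
  -- A square with one side collapsed to `a` is the triangle `a, b, c`.
  · let K : C(I × I, I × I) := ⟨fun p => (Icc.convexComb a.1 (Icc.convexComb b.1 c.1 p.1) p.2,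
      Icc.convexComb a.2 (Icc.convexComb b.2 c.2 p.1) p.2), by
        simp only [Icc.convexComb]; fun_prop⟩
    have := hsq (H.comp K)
    have e1 : (H.comp K).comp (seg (0, 1) (1, 1)) = H.comp (seg b c) := by ext r; simp [K]
    have e2 : (H.comp K).comp (seg (0, 0) (0, 1)) = H.comp (seg a b) := by ext r; simp [K]
    have e3 : (H.comp K).comp (seg (1, 0) (1, 1)) = H.comp (seg a c) := by ext r; simp [K]
    have e4 : (H.comp K).comp (seg (0, 0) (1, 0)) = .const I (H a) := by ext r; simp [K]
    rw [e1, e2, e3, e4, hconst, mul_one] at this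
    exact this
  · have := hΦ γ k 0 1 zero_le_one fun r _ => hγ r
    rwa [hΦ0, mul_one, cut_zero_one] at this

end VanKampen

end Transport

/-- A transport in `X` with values in `G`: an assignment of elements of `G` to the paths of `X` which
is multiplicative on singular triangles. -/
structure Transport (X G : Type*) [TopologicalSpace X] [Group G] where
  toFun : C(I, X) → G
  isTransportOn : IsTransportOn toFun univ

/-! ### Transports and homomorphisms from fundamental groups. -/

namespace Transport

variable {X Y G : Type*} [TopologicalSpace X] [TopologicalSpace Y] [Group G]

instance : CoeFun (Transport X G) fun _ => C(I, X) → G := ⟨toFun⟩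

variable (F : Transport X G)

lemma triangle (H : C(I × I, X)) (a b c : I × I) :
    F (H.comp (seg b c)) * F (H.comp (seg a b)) = F (H.comp (seg a c)) :=
  F.isTransportOn H (fun _ => mem_univ _) a b c

@[simp] lemma const (x : X) : F (.const I x) = 1 := F.isTransportOn.const (mem_univ x)

lemma square (H : C(I × I, X)) :
    F (H.comp (seg (0, 1) (1, 1))) * F (H.comp (seg (0, 0) (0, 1))) =
      F (H.comp (seg (1, 0) (1, 1))) * F (H.comp (seg (0, 0) (1, 0))) := by
  rw [F.triangle, F.triangle]

/-- The pullback of a transport along a continuous map. -/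
def comap (u : C(Y, X)) : Transport Y G where
  toFun γ := F (u.comp γ)
  isTransportOn H _ a b c := F.triangle (u.comp H) a b c

@[simp] lemma comap_apply (u : C(Y, X)) (γ : C(I, Y)) : F.comap u γ = F (u.comp γ) := rfl

lemma eq_of_homotopic {x y : X} {p q : Path x y} (h : p.Homotopic q) : F p = F q := by
  obtain ⟨H⟩ := h
  have := F.square H.toContinuousMap
  have e1 : H.toContinuousMap.comp (seg (0, 1) (1, 1)) = .const I y := by
    ext r; simp
  have e2 : H.toContinuousMap.comp (seg (0, 0) (0, 1)) = p := by
    ext r; simp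
  have e3 : H.toContinuousMap.comp (seg (1, 0) (1, 1)) = q := by
    ext r; simp
  have e4 : H.toContinuousMap.comp (seg (0, 0) (1, 0)) = .const I x := by
    ext r; simp
  simpa [e1, e2, e3, e4] using this

lemma cut_mul_cut (γ : C(I, X)) (a b c : I) : F (cut γ b c) * F (cut γ a b) = F (cut γ a c) :=
  F.triangle (γ.comp ContinuousMap.fst) (a, 0) (b, 0) (c, 0)

lemma trans {x y z : X} (p : Path x y) (q : Path y z) : F (p.trans q) = F q * F p := by
  obtain ⟨m, hm⟩ : ∃ m : I, (m : ℝ) = 1 / 2 := ⟨⟨1 / 2, by norm_num, by norm_num⟩, rfl⟩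
  have := F.cut_mul_cut (p.trans q : C(I, X)) 0 m 1
  have e1 : cut (p.trans q : C(I, X)) 0 m = p := by
    ext r
    have h0 : ((Icc.convexComb 0 m r : I) : ℝ) = r / 2 := by simp [hm]; ring
    simp only [cut_apply, ContinuousMap.coe_coe, Path.trans_apply, h0]
    rw [dif_pos (by linarith [r.2.2])]
    congr 1; ext; simp; ring
  have e2 : cut (p.trans q : C(I, X)) m 1 = q := by
    ext r
    have h0 : ((Icc.convexComb m 1 r : I) : ℝ) = (1 + r) / 2 := by simp [hm]; ring
    simp only [cut_apply, ContinuousMap.coe_coe, Path.trans_apply, h0]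
    split_ifs with h
    · obtain rfl : r = 0 := Subtype.ext (le_antisymm (by simp at h ⊢; linarith) r.2.1)
      simp
    · congr 1; ext; simp; ring
  rw [e1, e2, cut_zero_one] at this
  exact this.symm

lemma symm {x y : X} (p : Path x y) : F p.symm = (F p)⁻¹ := by
  rw [eq_inv_iff_mul_eq_one, ← F.trans, F.eq_of_homotopic (Path.Homotopic.trans_symm p)]
  exact F.const x

/-- The homomorphism from the fundamental group given by a transport. -/
def toHom (x : X) : FundamentalGroup X x →* G where
  toFun := Quotient.lift (fun p : Path x x => F p) fun _ _ h => F.eq_of_homotopic h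
  map_one' := F.const x
  -- A product in `FundamentalGroup` traverses its right factor first, which matches the
  -- right-to-left order of transports.
  map_mul' := by
    rintro ⟨p⟩ ⟨q⟩
    exact F.trans q p

lemma toHom_mk {x : X} (p : Path x x) : F.toHom x (FundamentalGroup.fromPath ⟦p⟧) = F p := rfl

section ofHom

variable {x₀ : X} (g : FundamentalGroup X x₀ →* G) (p : ∀ x, Path x₀ x)

/-- The value of a homomorphism on a path, closed up to a loop by given paths from the base
point. -/
def valueOfHom {x y : X} (q : Path.Homotopic.Quotient x y) : G :=
  g (FundamentalGroup.fromPath (((Path.Homotopic.Quotient.mk (p x)).trans q).trans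
    (Path.Homotopic.Quotient.mk (p y)).symm))

lemma valueOfHom_trans {x y z : X} (q : Path.Homotopic.Quotient x y)
    (r : Path.Homotopic.Quotient y z) :
    valueOfHom g p (q.trans r) = valueOfHom g p r * valueOfHom g p q := by
  rw [valueOfHom, valueOfHom, valueOfHom, ← map_mul, FundamentalGroup.mul_def]
  congr 1
  simp only [Path.Homotopic.Quotient.trans_assoc]
  rw [← Path.Homotopic.Quotient.trans_assoc (Path.Homotopic.Quotient.symm _) _ _,
    Path.Homotopic.Quotient.symm_trans, Path.Homotopic.Quotient.refl_trans]

/-- The transport given by a homomorphism from the fundamental group and paths from the base point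
to all other points. -/
def ofHom : Transport X G where
  toFun γ := valueOfHom g p (Path.Homotopic.Quotient.mk (⟨γ, rfl, rfl⟩ : Path (γ 0) (γ 1)))
  isTransportOn H _ a b c := by
    have : ContractibleSpace I := (convex_Icc (0 : ℝ) 1).contractibleSpace ⟨0, by simp⟩
    have key : ∀ (γ : C(I, X)) (x y : X) (hx : γ 0 = x) (hy : γ 1 = y),
        valueOfHom g p (Path.Homotopic.Quotient.mk (⟨γ, rfl, rfl⟩ : Path (γ 0) (γ 1))) =
          valueOfHom g p (Path.Homotopic.Quotient.mk (⟨γ, hx, hy⟩ : Path x y)) := by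
      rintro γ _ _ rfl rfl; rfl
    let s (a b : I × I) : Path a b := ⟨seg a b, by simp, by simp⟩
    have hs : ∀ a b, (⟨H.comp (seg a b), by simp, by simp⟩ : Path (H a) (H b)) =
        (s a b).map H.continuous := fun a b => rfl
    beta_reduce
    rw [key (H.comp (seg b c)) (H b) (H c) (by simp) (by simp),
      key (H.comp (seg a b)) (H a) (H b) (by simp) (by simp),
      key (H.comp (seg a c)) (H a) (H c) (by simp) (by simp), hs, hs, hs, ← valueOfHom_trans,
      ← Path.Homotopic.Quotient.mk_trans, ← Path.map_trans]
    congr 1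
    exact Quotient.sound ((SimplyConnectedSpace.paths_homotopic _ _).map H)

lemma ofHom_apply {x y : X} (q : Path x y) :
    ofHom g p q = valueOfHom g p (Path.Homotopic.Quotient.mk q) := by
  obtain ⟨γ, rfl, rfl⟩ := q; rfl

end ofHom

/-- Every homomorphism from the fundamental group of a path connected space is given by a
transport. -/
theorem exists_toHom_eq [PathConnectedSpace X] {x₀ : X} (g : FundamentalGroup X x₀ →* G) :
    ∃ F : Transport X G, F.toHom x₀ = g := by
  let q := fun x => PathConnectedSpace.somePath x₀ x
  -- This choice makes the loop `p x₀` null-homotopic, so that values on loops at `x₀` are not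
  -- conjugated.
  let p := fun x => (q x₀).symm.trans (q x)
  refine ⟨ofHom g p, MonoidHom.ext ?_⟩
  rintro ⟨γ⟩
  refine (ofHom_apply g p γ).trans ?_
  have hp : Path.Homotopic.Quotient.mk (p x₀) = Path.Homotopic.Quotient.refl x₀ := by
    simp only [p, Path.Homotopic.Quotient.mk_trans, Path.Homotopic.Quotient.mk_symm,
      Path.Homotopic.Quotient.symm_trans]
  rw [valueOfHom, hp]
  congr 1
  rw [Path.Homotopic.Quotient.refl_trans]
  exact Path.Homotopic.Quotient.trans_refl (Path.Homotopic.Quotient.mk γ)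

end Transport
end KnotTheory

namespace KnotTheory
open unitInterval Set Topology

/-! ### Filling a tube -/

/-- A continuous map whose values lie in the range of an embedding factors through it. -/
lemma exists_comp_eq {X Y Z : Type*} [TopologicalSpace X] [TopologicalSpace Y] [TopologicalSpace Z]
    {i : C(X, Y)} (hi : IsEmbedding i) (c : C(Z, Y)) (hc : ∀ z, c z ∈ range i) :
    ∃ c' : C(Z, X), i.comp c' = c := by
  choose f hf using hc
  exact ⟨⟨f, hi.continuous_iff.2 (by simpa [Function.comp_def, hf] using c.continuous)⟩,
    ContinuousMap.ext hf⟩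

namespace Transport

variable {A Y G : Type*} [TopologicalSpace A] [TopologicalSpace Y] [Group G]

/-- Values depend only on the endpoints, so integrating from a fixed base point gives a primitive.
-/
lemma exists_primitive [SimplyConnectedSpace Y] (F : Transport Y G) :
    ∃ ψ : Y → G, ∀ c : C(I, Y), F c = ψ (c 1) * (ψ (c 0))⁻¹ := by
  obtain ⟨y₀⟩ : Nonempty Y := inferInstance
  let p := fun y => PathConnectedSpace.somePath y₀ y
  refine ⟨fun y => F (p y), fun c => ?_⟩
  rw [eq_mul_inv_iff_mul_eq]
  exact (F.trans (p (c 0)) ⟨c, rfl, rfl⟩).symm.trans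
    (F.eq_of_homotopic (SimplyConnectedSpace.paths_homotopic _ _))

/-- A transport on the complement of the core of a tube extends over the core if it vanishes on the
meridian of the tube. -/
theorem exists_extension_of_meridian (F : Transport A G) (i : C(A, Y)) (hi : IsOpenEmbedding i)
    (τ : C(Circle × ℂ, Y)) (hτ : IsOpenEmbedding τ)
    (hcore : ∀ z w, τ (z, w) ∈ range i ↔ w ≠ 0) (hcov : range i ∪ range τ = univ)
    (hμ : ∀ c : C(I, A),
      (∀ t, i (c t) = τ (1, Complex.exp (2 * Real.pi * t * Complex.I))) → F c = 1) :
    ∃ F' : Transport Y G, ∀ c : C(I, A), F' (i.comp c) = F c := by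
  classical
  have hinj : ∀ {Z : Type} [TopologicalSpace Z] {c c' : C(Z, A)}, i.comp c = i.comp c' → c = c' :=
    fun h => ContinuousMap.ext fun t => hi.injective (DFunLike.congr_fun h t)
  -- The universal cover of the punctured tube; the pulled-back transport has a primitive `ψ` there.
  let e₀ : C(ℝ × ℂ, Circle × ℂ) := ⟨fun p => (Circle.exp p.1, Complex.exp p.2), by fun_prop⟩
  obtain ⟨E, hE⟩ := exists_comp_eq hi.isEmbedding (τ.comp e₀)
    fun p => (hcore _ _).2 (Complex.exp_ne_zero _)
  obtain ⟨P, hP⟩ := exists_comp_eq hi.isEmbedding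
    (τ.comp (⟨fun z => (z, 1), by fun_prop⟩ : C(Circle, Circle × ℂ)))
    fun p => (hcore _ _).2 one_ne_zero
  replace hE : ∀ p, i (E p) = τ (Circle.exp p.1, Complex.exp p.2) := DFunLike.congr_fun hE
  replace hP : ∀ z, i (P z) = τ (z, 1) := DFunLike.congr_fun hP
  have hEP : ∀ x : ℝ, E (x, 0) = P (Circle.exp x) := fun x => hi.injective (by simp [hE, hP])
  obtain ⟨ψ, hψ⟩ := exists_primitive (F.comap E)
  simp only [comap_apply] at hψ
  -- A path and its translate by `2πi` have the same image, so periodicity need only be known at the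
  -- origin, where it is the vanishing on the meridian.
  have hper : ∀ x, Function.Periodic (fun u => ψ (x, u)) (2 * Real.pi * Complex.I) := by
    intro x u
    let c₀ : C(I, ℝ × ℂ) := ⟨fun t => (0, 2 * Real.pi * t * Complex.I), by fun_prop⟩
    let c : C(I, ℝ × ℂ) := ⟨fun t => (t * x, t * u), by fun_prop⟩
    let c' : C(I, ℝ × ℂ) := ⟨fun t => (t * x, t * u + 2 * Real.pi * Complex.I), by fun_prop⟩
    have h0 := hψ c₀
    rw [hμ _ fun t => by simp [hE, c₀]] at h0
    have hcc : E.comp c = E.comp c' := ContinuousMap.ext fun t => hi.injective (by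
      simp [hE, c, c', Complex.exp_add])
    have h1 := hψ c
    rw [hcc, hψ c'] at h1
    simp only [c₀, c, c', ContinuousMap.coe_mk, Set.Icc.coe_one, Set.Icc.coe_zero,
      Complex.ofReal_one, Complex.ofReal_zero, one_mul, zero_mul, mul_one, mul_zero, zero_add]
      at h0 h1
    rw [eq_comm, mul_inv_eq_one] at h0
    rw [h0] at h1
    exact mul_right_cancel h1
  let e' : ℝ × ℂ → G := fun p => ψ p * (ψ (p.1, 0))⁻¹
  have he' : ∀ x x' u u', Circle.exp x = Circle.exp x' → Complex.exp u = Complex.exp u' →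
      e' (x, u) = e' (x', u') := by
    intro x x' u u' hx hu
    obtain ⟨n, rfl⟩ := Complex.exp_eq_exp_iff_exists_int.1 hu
    let c (x : ℝ) : C(I, ℝ × ℂ) := ⟨fun t => (x, t * u'), by fun_prop⟩
    have h : ∀ x, e' (x, u') = F (E.comp (c x)) := fun x => by rw [hψ]; simp [c, e']
    have hcc : E.comp (c x) = E.comp (c x') := ContinuousMap.ext fun t => hi.injective (by
      simp [hE, c, hx])
    calc e' (x, _) = e' (x, u') := by
          simp only [e']; rw [show ψ (x, u' + n * (2 * Real.pi * Complex.I)) = ψ (x, u') from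
            (hper x).int_mul n u']
      _ = _ := by rw [h, h, hcc]
  let e : Circle × ℂ → G := fun p => e' (Complex.arg p.1, Complex.log p.2)
  -- Off the core this rewrites `F` as passage to the parallel `τ (z, 1)`, motion along it and
  -- return. The formula also makes sense on paths through the core: the factors `e` cancel when
  -- paths are composed, so the value of `e` there (from `Complex.log 0 = 0`) is immaterial.
  let val : C(I, Circle × ℂ) → G := fun c =>
    e (c 1) * F (P.comp (ContinuousMap.fst.comp c)) * (e (c 0))⁻¹
  have hval : ∀ (c : C(I, A)) (c' : C(I, Circle × ℂ)), i.comp c = τ.comp c' → F c = val c' := by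
    intro c c' hcc
    have hne : ∀ t, (c' t).2 ≠ 0 := fun t =>
      (hcore (c' t).1 _).1 ⟨c t, DFunLike.congr_fun hcc t⟩
    obtain ⟨x, hx, -⟩ := Circle.isCoveringMap_exp.exists_path_lifts (ContinuousMap.fst.comp c')
      (Complex.arg (c' 0).1) (by simp [Circle.exp_arg])
    obtain ⟨u, hu, -⟩ := Complex.isCoveringMap_exp.exists_path_lifts
      (⟨fun t => ⟨(c' t).2, hne t⟩, by fun_prop⟩ : C(I, {z : ℂ // z ≠ 0}))
      (Complex.log (c' 0).2) (Subtype.ext (by simp [Complex.exp_log (hne 0)]))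
    replace hx : ∀ t, Circle.exp (x t) = (c' t).1 := congrFun hx
    replace hu : ∀ t, Complex.exp (u t) = (c' t).2 := fun t => congrArg Subtype.val (congrFun hu t)
    have h1 : c = E.comp (x.prodMk u) := hinj (hcc.trans (ContinuousMap.ext fun t => by
      simp [hE, hx, hu]))
    have h2 : P.comp (ContinuousMap.fst.comp c') = E.comp (x.prodMk (.const I 0)) :=
      ContinuousMap.ext fun t => by simp [hEP, hx]
    have h3 : ∀ t, e (c' t) = e' (x t, u t) := fun t => he' _ _ _ _
      (by rw [hx, Circle.exp_arg]) (by rw [hu, Complex.exp_log (hne t)])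
    simp only [val]
    rw [h1, h2, h3, h3, hψ, hψ]
    change ψ (x 1, u 1) * (ψ (x 0, u 0))⁻¹ = ψ (x 1, u 1) * (ψ (x 1, 0))⁻¹ *
      (ψ (x 1, 0) * (ψ (x 0, 0))⁻¹) * (ψ (x 0, u 0) * (ψ (x 0, 0))⁻¹)⁻¹
    group
  let v : C(I, Y) → G := fun c => if h : ∃ c', i.comp c' = c then F h.choose else
    if h : ∃ c', τ.comp c' = c then val h.choose else 1
  have hvi : ∀ c, v (i.comp c) = F c := by
    intro c
    have h : ∃ c', i.comp c' = i.comp c := ⟨c, rfl⟩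
    simp only [v, h, dif_pos]
    rw [hinj h.choose_spec]
  have hvτ : ∀ c, v (τ.comp c) = val c := by
    intro c
    by_cases h : ∃ c', i.comp c' = τ.comp c
    · simp only [v, h, dif_pos]
      exact hval _ _ h.choose_spec
    · have h' : ∃ c', τ.comp c' = τ.comp c := ⟨c, rfl⟩
      simp only [v, h, h', dif_pos, dif_neg, not_false_eq_true]
      congr 1
      exact ContinuousMap.ext fun t => hτ.injective (DFunLike.congr_fun h'.choose_spec t)
  obtain ⟨w, hw, hwv⟩ := exists_isTransportOn_univ (v := v)
    (U := fun b : Bool => if b then range i else range τ)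
    (fun b => by cases b <;> simp [hi.isOpen_range, hτ.isOpen_range])
    (fun y => by
      rcases (hcov ▸ mem_univ y : y ∈ range i ∪ range τ) with h | h
      · exact ⟨true, by simpa using h⟩
      · exact ⟨false, by simpa using h⟩)
    (fun b => by
      intro H hH a b' c
      cases b
      · obtain ⟨K, rfl⟩ := exists_comp_eq hτ.isEmbedding H (by simpa using hH)
        simp only [ContinuousMap.comp_assoc, hvτ]
        have := F.triangle (P.comp (ContinuousMap.fst.comp K)) a b' c
        simp only [ContinuousMap.comp_assoc] at this
        simp only [val]
        rw [← this]
        simp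
        group
      · obtain ⟨K, rfl⟩ := exists_comp_eq hi.isEmbedding H (by simpa using hH)
        simp only [ContinuousMap.comp_assoc, hvi]
        exact F.triangle K a b' c)
  exact ⟨⟨w, hw⟩, fun c => (hwv true _ (by simp)).trans (hvi c)⟩

end Transport
end KnotTheory

namespace KnotTheory
open unitInterval Set Topology

/-! ### Generation of the fundamental group by an open cover -/

section Generation

variable {X G : Type*} [TopologicalSpace X] [Group G]

/-- If `X` is the union of two path connected open sets with path connected intersection, then the
classes of the loops in these two sets generate the fundamental group. -/
theorem map_mem_of_open_cover {A B : Set X} (hA : IsOpen A) (hB : IsOpen B) (hAB : A ∪ B = univ)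
    (hAc : IsPathConnected A) (hBc : IsPathConnected B) (hABc : IsPathConnected (A ∩ B)) {x₀ : X}
    (hx₀ : x₀ ∈ A ∩ B) (f : FundamentalGroup X x₀ →* G) (H : Subgroup G)
    (hfA : ∀ γ : Path x₀ x₀, (∀ t, γ t ∈ A) → f (FundamentalGroup.fromPath ⟦γ⟧) ∈ H)
    (hfB : ∀ γ : Path x₀ x₀, (∀ t, γ t ∈ B) → f (FundamentalGroup.fromPath ⟦γ⟧) ∈ H)
    (g : FundamentalGroup X x₀) : f g ∈ H := by
  -- With connecting paths that stay in every set containing their endpoint, each piece of a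
  -- subdivided loop closes up to a loop within `A` or within `B`.
  have hp : ∀ x, ∃ p : Path x₀ x, (x ∈ A → ∀ t, p t ∈ A) ∧ (x ∈ B → ∀ t, p t ∈ B) := by
    intro x
    by_cases hxA : x ∈ A <;> by_cases hxB : x ∈ B
    · obtain ⟨p, hp⟩ := hABc.joinedIn x₀ hx₀ x ⟨hxA, hxB⟩
      exact ⟨p, fun _ t => (hp t).1, fun _ t => (hp t).2⟩
    · obtain ⟨p, hp⟩ := hAc.joinedIn x₀ hx₀.1 x hxA
      exact ⟨p, fun _ t => hp t, fun h => absurd h hxB⟩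
    · obtain ⟨p, hp⟩ := hBc.joinedIn x₀ hx₀.2 x hxB
      exact ⟨p, fun h => absurd h hxA, fun _ t => hp t⟩
    · exact absurd (hAB ▸ mem_univ x) (by simp [hxA, hxB])
  choose p hpA hpB using hp
  have hloop : ∀ (S : Set X), (∀ x ∈ S, ∀ t, p x t ∈ S) →
      (∀ γ : Path x₀ x₀, (∀ t, γ t ∈ S) → f (FundamentalGroup.fromPath ⟦γ⟧) ∈ H) →
      ∀ c : C(I, X), (∀ t, c t ∈ S) → Transport.ofHom f p c ∈ H := by
    intro S hS hf c hc
    refine hf (((p (c 0)).trans (⟨c, rfl, rfl⟩ : Path (c 0) (c 1))).trans (p (c 1)).symm) ?_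
    rw [← range_subset_iff, Path.trans_range, Path.trans_range, Path.symm_range, union_subset_iff,
      union_subset_iff, range_subset_iff, range_subset_iff, range_subset_iff]
    exact ⟨⟨hS _ (hc 0), hc⟩, hS _ (hc 1)⟩
  have hF : ∀ c : C(I, X), Transport.ofHom f p c ∈ H := by
    intro c
    obtain ⟨t, ht0, hm, ⟨N, hN⟩, h⟩ := exists_partition
      (U := fun b : Bool => if b then A else B) (fun b => by cases b <;> simp [hA, hB])
      (fun x => by
        rcases (hAB ▸ mem_univ x : x ∈ A ∪ B) with h | h
        · exact ⟨true, by simpa using h⟩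
        · exact ⟨false, by simpa using h⟩) c
    suffices ∀ n, Transport.ofHom f p (cut c 0 (t n)) ∈ H by
      simpa [hN] using this N
    intro n
    induction n with
    | zero => simp [ht0, H.one_mem]
    | succ n ih =>
      rw [← Transport.cut_mul_cut _ c 0 (t n)]
      refine H.mul_mem ?_ ih
      obtain ⟨b, hb⟩ := h n
      cases b
      · exact hloop B (fun x hx => hpB x hx) hfB _ fun r =>
          by simpa using hb _ (convexComb_mem_Icc (hm n.le_succ) r)
      · exact hloop A (fun x hx => hpA x hx) hfA _ fun r =>
          by simpa using hb _ (convexComb_mem_Icc (hm n.le_succ) r)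
  induction g using Quotient.ind with | _ γ =>
  have hδ := hfA (p x₀) (hpA x₀ hx₀.1)
  set δ : FundamentalGroup X x₀ := FundamentalGroup.fromPath ⟦p x₀⟧
  set c : FundamentalGroup X x₀ := FundamentalGroup.fromPath ⟦γ⟧
  have hγ := hF γ
  rw [Transport.ofHom_apply] at hγ
  have h : f (δ⁻¹ * (c * δ)) ∈ H := hγ
  rw [map_mul, map_mul, map_inv] at h
  exact (H.mul_mem_cancel_right hδ).1 ((H.mul_mem_cancel_left (H.inv_mem hδ)).1 h)

lemma Transport.eq_one_of_toHom_eq_one [PathConnectedSpace X] (F : Transport X G) (x₀ : X)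
    (h : F.toHom x₀ = 1) {x : X} (γ : Path x x) : F γ = 1 := by
  let p := PathConnectedSpace.somePath x₀ x
  have := DFunLike.congr_fun h (FundamentalGroup.fromPath ⟦(p.trans γ).trans p.symm⟧)
  rw [toHom_mk, F.trans, F.trans, F.symm, MonoidHom.one_apply, inv_mul_eq_one, eq_comm,
    mul_eq_right] at this
  exact this

end Generation

/-! ### The 3-sphere is simply connected -/

section Sphere

variable {G : Type*} [Group G]

instance : PathConnectedSpace S3 :=
  isPathConnected_iff_pathConnectedSpace.1
    (isPathConnected_sphere (by rw [← Module.finrank_eq_rank]; simp) 0 zero_le_one)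

/-- Stereographic projection identifies the complement of `v` with a vector space. -/
lemma Transport.eq_one_of_avoids (F : Transport S3 G) (v : S3) {x : S3} (γ : Path x x)
    (hγ : ∀ t, γ t ≠ v) : F γ = 1 := by
  have hv : ‖(v : EuclideanSpace ℝ (Fin 4))‖ = 1 := by simp
  let e := stereographic hv
  have hsrc : ∀ t, γ t ∈ e.source := fun t => by
    rw [stereographic_source]; exact hγ t
  let s : C(_, S3) := ⟨e.symm, by
    rw [← continuousOn_univ, ← stereographic_target hv]; exact e.continuousOn_symm⟩
  let c : C(I, _) := ⟨fun t => e (γ t), e.continuousOn.comp_continuous γ.continuous hsrc⟩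
  have h : (γ : C(I, S3)) = s.comp c := ContinuousMap.ext fun t => (e.left_inv (hsrc t)).symm
  obtain ⟨ψ, hψ⟩ := (F.comap s).exists_primitive
  rw [h]
  refine (hψ c).trans ?_
  simp [c]

/-- The complements of two antipodal points generate, since they meet in a copy of punctured ℝ³,
which is path connected. -/
theorem Transport.eq_one_of_sphere (F : Transport S3 G) {x : S3} (γ : Path x x) : F γ = 1 := by
  obtain ⟨v⟩ : Nonempty S3 := inferInstance
  have hv : ‖(v : EuclideanSpace ℝ (Fin 4))‖ = 1 := by simp
  have hopen : ∀ v : S3, IsPathConnected ({v}ᶜ : Set S3) := by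
    intro v
    have hv : ‖(v : EuclideanSpace ℝ (Fin 4))‖ = 1 := by simp
    have := (stereographic hv).symm_image_target_eq_source
    rw [stereographic_source] at this
    rw [show ({v}ᶜ : Set S3) = _ from this.symm]
    refine IsPathConnected.image' ?_ (stereographic hv).continuousOn_symm
    rw [stereographic_target]
    exact isPathConnected_univ
  have hinter : IsPathConnected (({v}ᶜ : Set S3) ∩ {-v}ᶜ) := by
    let e := stereographic hv
    have he : e (-v) = 0 := stereographic_apply_neg v
    have : ({v}ᶜ : Set S3) ∩ {-v}ᶜ = e.symm '' {0}ᶜ := by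
      ext y
      constructor
      · rintro ⟨hy, hy'⟩
        have hys : y ∈ e.source := by rwa [stereographic_source]
        refine ⟨e y, fun h => hy' ?_, e.left_inv hys⟩
        have hns : -v ∈ e.source := by
          rw [stereographic_source]
          exact fun h => absurd h (by simpa using (ne_neg_of_mem_unit_sphere ℝ v).symm)
        exact e.injOn hys hns (by rw [he]; exact h)
      · rintro ⟨u, hu, rfl⟩
        have hut : u ∈ e.target := by rw [stereographic_target]; trivial
        refine ⟨?_, fun h => hu ?_⟩
        · have := e.map_target hut
          rwa [stereographic_source] at this
        · rw [← e.right_inv hut, show e.symm u = -v from h, he]; rfl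
    rw [this]
    refine IsPathConnected.image' ?_ (e.continuousOn_symm.mono ?_)
    · refine isPathConnected_compl_singleton_of_one_lt_rank ?_ 0
      rw [← Module.finrank_eq_rank, Submodule.finrank_orthogonal_span_singleton (n := 3) (by
        intro h; simp [h] at hv)]
      norm_num
    · rw [stereographic_target]; exact subset_univ _
  obtain ⟨x₀, hx₀⟩ := hinter.nonempty
  refine F.eq_one_of_toHom_eq_one x₀ (MonoidHom.ext fun g => ?_) γ
  have := map_mem_of_open_cover isClosed_singleton.isOpen_compl isClosed_singleton.isOpen_compl
    (by
      rw [← compl_inter, singleton_inter_eq_empty.2, compl_empty]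
      simpa using ne_neg_of_mem_unit_sphere ℝ v) (hopen v) (hopen (-v)) hinter hx₀ (F.toHom x₀) ⊥
    (fun γ hγ => F.eq_one_of_avoids v γ hγ) (fun γ hγ => F.eq_one_of_avoids (-v) γ hγ) g
  exact this

end Sphere

/-! ### Complements of knots are path connected -/

/-- A path in `D` that meets `C` is already in `U` shortly before it first does so; from there one
continues in `U \ C`. -/
lemma _root_.IsPathConnected.diff_of_subset_open {X : Type*} [TopologicalSpace X] {D C U : Set X}
    (hD : IsPathConnected D) (hC : IsClosed C) (hU : IsOpen U) (hCU : C ⊆ U) (hUD : U ⊆ D)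
    (hUC : IsPathConnected (U \ C)) : IsPathConnected (D \ C) := by
  obtain ⟨u, hu⟩ := hUC.nonempty
  refine ⟨u, ⟨hUD hu.1, hu.2⟩, fun p hp => JoinedIn.symm ?_⟩
  obtain ⟨γ, hγ⟩ := hD.joinedIn p hp.1 u (hUD hu.1)
  by_cases hS : (γ ⁻¹' C).Nonempty
  · have hSc : IsClosed (γ ⁻¹' C) := hC.preimage γ.continuous
    have ht₀ := hSc.csInf_mem hS (OrderBot.bddBelow _)
    set t₀ := sInf (γ ⁻¹' C)
    have h0 : 0 < t₀ := by
      refine lt_of_le_of_ne nonneg' fun h => hp.2 ?_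
      have : γ t₀ ∈ C := ht₀
      rwa [← h, γ.source] at this
    have hne : (𝓝[<] t₀).NeBot := nhdsLT_neBot_of_exists_lt ⟨0, h0⟩
    have htU : γ ⁻¹' U ∈ 𝓝[<] t₀ :=
      mem_nhdsWithin_of_mem_nhds ((hU.preimage γ.continuous).mem_nhds (hCU ht₀))
    obtain ⟨t, htU, ht⟩ := Filter.nonempty_of_mem (Filter.inter_mem htU self_mem_nhdsWithin)
    have hlt : ∀ s ≤ t, γ s ∉ C := fun s hs hsC =>
      absurd (csInf_le (OrderBot.bddBelow _) (show s ∈ γ ⁻¹' C from hsC)) (not_le.2 (hs.trans_lt ht))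
    refine JoinedIn.trans (y := γ t) ?_
      ((hUC.joinedIn _ ⟨htU, hlt t le_rfl⟩ u hu).mono (sdiff_subset_sdiff_left hUD))
    refine ⟨(γ.subpath 0 t).cast γ.source.symm rfl, fun s => ⟨hγ _, ?_⟩⟩
    exact hlt _ (Icc.convexComb_le nonneg' s)
  · exact ⟨γ, fun t => ⟨hγ t, fun h => hS ⟨t, h⟩⟩⟩

namespace Knot

lemma continuous_toFun (K : Knot) : Continuous K.toFun := K.isSmoothEmbedding.contMDiff.continuous

lemma isClosed_image (K : Knot) : IsClosed K.image :=
  (isCompact_range K.continuous_toFun).isClosed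

namespace IsTube

variable {K : Knot} {τ : Circle × ℂ → S3}

lemma continuous (h : K.IsTube τ) : Continuous τ := h.isLocalDiffeomorph.contMDiff.continuous

lemma isOpenEmbedding (h : K.IsTube τ) : IsOpenEmbedding τ :=
  .of_continuous_injective_isOpenMap h.continuous h.injective h.isLocalDiffeomorph.isOpenMap

lemma mem_image_iff (h : K.IsTube τ) (z : Circle) (w : ℂ) : τ (z, w) ∈ K.image ↔ w = 0 := by
  constructor
  · rintro ⟨z', hz'⟩
    rw [← h.core] at hz'
    exact (Prod.ext_iff.1 (h.injective hz')).2.symm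
  · rintro rfl
    exact ⟨z, (h.core z).symm⟩

lemma image_subset_range (h : K.IsTube τ) : K.image ⊆ range τ := by
  rintro _ ⟨z, rfl⟩
  exact ⟨(z, 0), h.core z⟩

lemma isPathConnected_range_diff (h : K.IsTube τ) : IsPathConnected (range τ \ K.image) := by
  have : range τ \ K.image = τ '' (univ ×ˢ {0}ᶜ) := by
    ext y
    constructor
    · rintro ⟨⟨⟨z, w⟩, rfl⟩, hy⟩
      exact ⟨(z, w), ⟨trivial, fun hw => hy ((h.mem_image_iff z w).2 hw)⟩, rfl⟩
    · rintro ⟨⟨z, w⟩, ⟨-, hw⟩, rfl⟩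
      exact ⟨⟨_, rfl⟩, fun hy => hw ((h.mem_image_iff z w).1 hy)⟩
  rw [this]
  refine IsPathConnected.image (.prod ?_ ?_) h.continuous
  · rw [← Circle.exp_surjective.range_eq]
    exact isPathConnected_range Circle.exp.continuous
  · exact isPathConnected_compl_singleton_of_one_lt_rank (by simp) 0

lemma isPathConnected_diff (h : K.IsTube τ) {D : Set S3} (hD : IsPathConnected D)
    (hτ : range τ ⊆ D) : IsPathConnected (D \ K.image) :=
  hD.diff_of_subset_open K.isClosed_image h.isOpenEmbedding.isOpen_range h.image_subset_range hτ
    h.isPathConnected_range_diff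

lemma isPathConnected_compl (h : K.IsTube τ) : IsPathConnected K.imageᶜ := by
  rw [compl_eq_univ_sdiff]
  exact h.isPathConnected_diff isPathConnected_univ (subset_univ _)

end IsTube

end Knot
end KnotTheory

namespace KnotTheory
open unitInterval Set Topology

/-! ### Closed curves, free homotopy and conjugacy -/

section Curves

variable {X G : Type*} [TopologicalSpace X] [Group G]

lemma exists_circle_exp_eq (z : Circle) : ∃ θ : I, Circle.exp (2 * Real.pi * θ) = z := by
  obtain ⟨x, rfl⟩ := Circle.exp_surjective z
  have hpi : 2 * Real.pi ≠ 0 := by positivity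
  refine ⟨⟨Int.fract (x / (2 * Real.pi)), Int.fract_nonneg _, (Int.fract_lt_one _).le⟩, ?_⟩
  rw [Circle.exp_eq_exp]
  refine ⟨-⌊x / (2 * Real.pi)⌋, ?_⟩
  simp only [Int.fract]
  push_cast
  field_simp
  ring

/-- A homotopy of closed paths defines a homotopy of closed curves. -/
lemma exists_circle_homotopy (K : C(I × I, X)) (hK : ∀ s, K (s, 0) = K (s, 1)) :
    ∃ k : C(I × Circle, X), ∀ (s θ : I), k (s, Circle.exp (2 * Real.pi * (θ : ℝ))) = K (s, θ) := by
  let q : C(I × I, I × Circle) :=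
    ⟨fun p => (p.1, Circle.exp (2 * Real.pi * (p.2 : ℝ))), by fun_prop⟩
  have hq : IsQuotientMap q := q.continuous.isClosedMap.isQuotientMap q.continuous (by
    rintro ⟨s, z⟩
    obtain ⟨θ, rfl⟩ := exists_circle_exp_eq z
    exact ⟨(s, θ), rfl⟩)
  have h01 : ∀ {s θ θ' : I}, θ ≤ θ' →
      Circle.exp (2 * Real.pi * (θ : ℝ)) = Circle.exp (2 * Real.pi * (θ' : ℝ)) →
      K (s, θ) = K (s, θ') := by
    intro s θ θ' hle h
    obtain ⟨m, hm⟩ := Circle.exp_eq_exp.1 h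
    have hm' : (θ : ℝ) = θ' + m := by
      have hpi : 2 * Real.pi ≠ 0 := by positivity
      apply mul_left_cancel₀ hpi
      linarith
    have hle' : (θ : ℝ) ≤ θ' := hle
    have hb := θ.2.1
    have hb' := θ'.2.2
    have h1 : (m : ℝ) ≤ 0 := by linarith
    have h2 : (-1 : ℝ) ≤ m := by linarith
    norm_cast at h1 h2
    obtain rfl | rfl : m = 0 ∨ m = -1 := by omega
    · congr 2; ext; simpa using hm'
    · push_cast at hm'
      obtain rfl : θ = 0 := Subtype.ext (by rw [Icc.coe_zero]; linarith)
      obtain rfl : θ' = 1 := Subtype.ext (by rw [Icc.coe_one]; rw [Icc.coe_zero] at hm'; linarith)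
      exact hK s
  have hfac : Function.FactorsThrough K q := by
    rintro ⟨s, θ⟩ ⟨s', θ'⟩ h
    obtain ⟨rfl, h⟩ := Prod.ext_iff.1 h
    rcases le_total θ θ' with hle | hle
    · exact h01 hle h
    · exact (h01 hle h.symm).symm
  exact ⟨hq.lift K hfac, fun s θ => DFunLike.congr_fun (hq.lift_comp K hfac) (s, θ)⟩

/-- The value on the track of the base point conjugates one value to the other. -/
lemma Transport.isConj_of_homotopic (F : Transport X G) {c d : C(Circle, X)}
    (h : d.Homotopic c) : IsConj (F (circleLoop d)) (F (circleLoop c)) := by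
  obtain ⟨H⟩ := h
  let K : C(I × I, X) := ⟨fun p => H (p.1, Circle.exp (2 * Real.pi * (p.2 : ℝ))), by fun_prop⟩
  have := F.square K
  have e1 : K.comp (seg (0, 1) (1, 1)) = K.comp (seg (0, 0) (1, 0)) := by ext r; simp [K]
  have e2 : K.comp (seg (0, 0) (0, 1)) = circleLoop d := by ext r; simp [K, circleLoop]
  have e3 : K.comp (seg (1, 0) (1, 1)) = circleLoop c := by ext r; simp [K, circleLoop]
  rw [e1, e2, e3] at this
  exact isConj_iff.2 ⟨_, mul_inv_eq_iff_eq_mul.2 this⟩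

/-- A closed curve can be moved along a path that ends at its base point. -/
lemma exists_homotopic_circleLoop_eq (c : C(Circle, X)) {x : X} (δ : Path x (c 1)) :
    ∃ d : C(Circle, X), d.Homotopic c ∧ ∃ h : d 1 = x,
      (circleLoop d).cast h.symm h.symm = δ.trans ((circleLoop c).trans δ.symm) := by
  -- `δ` on `[-1, 0]`, then `c` on `[0, 1]`, then `δ` reversed on `[1, 2]`.
  let Γ : ℝ → X := fun t => if t ≤ 0 then δ.extend (1 + t) else
    if t ≤ 1 then c (Circle.exp (2 * Real.pi * t)) else δ.extend (2 - t)
  have hΓ : Continuous Γ := by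
    refine Continuous.if_le (by fun_prop) (Continuous.if_le (by fun_prop) (by fun_prop)
      continuous_id continuous_const ?_) continuous_id continuous_const ?_
    · rintro t rfl
      norm_num
    · rintro t rfl
      norm_num
  have h0 : ∀ s : I, Γ (-(1 - s)) = δ s := by
    intro s
    have := s.2.2
    simp only [Γ]
    rw [if_pos (by linarith)]
    simp
  have h2 : ∀ s : I, Γ (2 - s) = δ s := by
    intro s
    have := s.2.2
    rcases this.eq_or_lt with h | h
    · obtain rfl : s = 1 := Subtype.ext h
      norm_num [Γ]
    · simp only [Γ]
      rw [if_neg (by linarith), if_neg (by linarith)]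
      simp
  have h1 : ∀ θ : I, Γ θ = c (Circle.exp (2 * Real.pi * (θ : ℝ))) := by
    intro θ
    rcases θ.2.1.eq_or_lt with h | h
    · obtain rfl : θ = 0 := Subtype.ext h.symm
      simp [Γ]
    · simp only [Γ]
      rw [if_neg (by linarith), if_pos θ.2.2]
  -- The maximum maps `[0, 1]` onto `[-1, 2]` with the breakpoints 1/2 and 3/4 of the nested
  -- `Path.trans`. At time `s` the parameter runs from `-(1 - s)` to `2 - s`, where `Γ` is `δ s` at
  -- both ends, so the curve stays closed.
  let K : C(I × I, X) := ⟨fun p => Γ ((1 - p.1) * max (2 * (p.2 : ℝ) - 1) (4 * p.2 - 2) + p.1 * p.2),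
    by fun_prop⟩
  obtain ⟨k, hk⟩ := exists_circle_homotopy K fun s => by
    have e0 : K (s, 0) = Γ (-(1 - s)) := by simp [K]
    have e1 : K (s, 1) = Γ (2 - s) := by
      simp only [K, ContinuousMap.coe_mk, Icc.coe_one]; norm_num; congr 1; ring
    rw [e0, e1, h0, h2]
  let d : C(Circle, X) := k.comp ⟨fun z => (0, z), by fun_prop⟩
  have hd : ∀ θ : I, d (Circle.exp (2 * Real.pi * (θ : ℝ))) =
      Γ (max (2 * (θ : ℝ) - 1) (4 * θ - 2)) := by
    intro θ
    exact (hk 0 θ).trans (by simp [K])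
  have hd1 : d 1 = x := by
    have := hd 0
    have h0 := h0 0
    simp at this h0
    rw [this, h0]
  refine ⟨d, ⟨⟨k, fun z => rfl, fun z => ?_⟩⟩, hd1, ?_⟩
  · obtain ⟨θ, rfl⟩ := exists_circle_exp_eq z
    refine (hk 1 θ).trans ?_
    rw [← h1]
    simp [K]
  · ext θ
    refine (hd θ).trans ?_
    rw [Path.trans_apply]
    split_ifs with hθ
    · rw [max_eq_left (by linarith)]
      simp only [Γ]
      rw [if_pos (by linarith)]
      simp only [add_sub_cancel]
      exact δ.extend_apply _
    · push Not at hθ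
      rw [max_eq_right (by linarith), Path.trans_apply]
      simp only
      split_ifs with hθ'
      · simp only [Γ]
        rw [if_neg (by linarith), if_pos (by linarith)]
        simp only [circleLoop, Path.coe_mk', ContinuousMap.coe_mk]
        congr 3; ring
      · refine Eq.trans ?_ (h2 (unitInterval.symm
          ⟨2 * (2 * (θ : ℝ) - 1) - 1, by linarith, by linarith [show (θ : ℝ) ≤ 1 from θ.2.2]⟩))
        congr 1
        rw [coe_symm_eq]
        ring

end Curves

namespace Knot

lemma IsMeridian.conj {K : Knot} {x : K.Complement} {g : K.group x} (hg : K.IsMeridian g)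
    (h : K.group x) : K.IsMeridian (h * g * h⁻¹) := by
  obtain ⟨τ, hτ, c, d, hc, hdc, rfl, rfl⟩ := hg
  -- Dragging the base point along a loop `y` gives the class `y⁻¹ * g * y`.
  obtain ⟨h, rfl⟩ : ∃ h', h'⁻¹ = h := ⟨h⁻¹, inv_inv h⟩
  induction h using Quotient.ind with | _ η =>
  obtain ⟨d', hd', e, he⟩ := exists_homotopic_circleLoop_eq d η
  refine ⟨τ, hτ, c, d', hc, hd'.trans hdc, e, ?_⟩
  rw [he]
  let y : K.group (d 1) := FundamentalGroup.fromPath ⟦η⟧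
  change y⁻¹ * _ * y⁻¹⁻¹ = _
  rw [inv_inv]
  rfl

variable {K : Knot} {G : Type*} [Group G]

/-- The value of a transport on a meridian is conjugate to its value on the meridian curve of a
tube. -/
lemma IsMeridian.exists_isConj {x : K.Complement} {m : K.group x} (hm : K.IsMeridian m)
    (F : Transport K.Complement G) : ∃ τ, K.IsTube τ ∧ ∃ c : C(Circle, K.Complement),
      (∀ w : Circle, (c w : S3) = τ (1, (w : ℂ))) ∧ IsConj (F.toHom x m) (F (circleLoop c)) := by
  obtain ⟨τ, hτ, c, d, hc, hdc, rfl, rfl⟩ := hm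
  exact ⟨τ, hτ, c, hc, F.isConj_of_homotopic hdc⟩

lemma IsTube.exists_isMeridian {τ : Circle × ℂ → S3} (hτ : K.IsTube τ) {c : C(Circle, K.Complement)}
    (hc : ∀ w : Circle, (c w : S3) = τ (1, (w : ℂ))) {x : K.Complement} (δ : Path x (c 1))
    (F : Transport K.Complement G) :
    ∃ m : K.group x, K.IsMeridian m ∧ IsConj (F (circleLoop c)) (F.toHom x m) := by
  obtain ⟨d, hd, rfl, -⟩ := exists_homotopic_circleLoop_eq c δ
  exact ⟨_, ⟨τ, hτ, c, d, hc, hd, rfl, rfl⟩, (F.isConj_of_homotopic hd).symm⟩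

end Knot
end KnotTheory

namespace KnotTheory

/-! ### Knots with trivial Alexander polynomial -/

/-- Cramer's rule: multiplying a square matrix of relations by its adjugate shows that the
determinant kills the generators. -/
lemma smul_eq_zero_of_mem_orderIdeal {R M : Type*} [CommRing R] [AddCommGroup M] [Module R M]
    {d : R} (hd : d ∈ orderIdeal R M) (x : M) : d • x = 0 := by
  suffices orderIdeal R M ≤ Module.annihilator R M from Module.mem_annihilator.1 (this hd) x
  refine Ideal.span_le.2 ?_
  rintro _ ⟨n, v, A, hv, hA, rfl⟩
  refine Module.mem_annihilator.2 fun x => ?_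
  have hx : x ∈ Submodule.span R (Set.range v) := hv ▸ Submodule.mem_top
  induction hx using Submodule.span_induction with
  | mem x h =>
    obtain ⟨k, rfl⟩ := h
    calc A.det • v k = ∑ j, (A.adjugate * A) k j • v j := by
          simp [Matrix.adjugate_mul, Matrix.smul_apply, Matrix.one_apply]
      _ = ∑ i, A.adjugate k i • ∑ j, A i j • v j := by
          simp only [Matrix.mul_apply, Finset.sum_smul, Finset.smul_sum, smul_smul]
          exact Finset.sum_comm
      _ = 0 := by simp [hA]
  | zero => simp
  | add x y _ _ hx hy => rw [smul_add, hx, hy, add_zero]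
  | smul a x _ hx => rw [smul_comm, hx, smul_zero]

/-- If `G' = G''`, then homomorphisms to residually solvable groups vanish on `G'`. -/
lemma map_eq_one_of_mem_commutator {G N : Type*} [Group G] [Group N] (hN : IsResiduallySolvable N)
    (m : G) (hm : orderIdeal ℤ[T;T⁻¹] (AlexanderModule m) = ⊤) (f : G →* N) {x : G}
    (hx : x ∈ commutator G) : f x = 1 := by
  have hzero : ∀ y : AlexanderModule m, y = 0 := fun y => by
    simpa using smul_eq_zero_of_mem_orderIdeal
      (hm ▸ Submodule.mem_top : (1 : ℤ[T;T⁻¹]) ∈ orderIdeal _ (AlexanderModule m)) y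
  have htop : commutator (commutator G) = ⊤ := by
    rw [eq_top_iff]
    intro y _
    exact (QuotientGroup.eq_one_iff y).1 (hzero (Additive.ofMul (Abelianization.of y)))
  have hperf : ⁅commutator G, commutator G⁆ = commutator G := by
    have := congrArg (Subgroup.map (commutator G).subtype) htop
    rwa [Subgroup.map_subtype_commutator, ← MonoidHom.range_eq_map, Subgroup.range_subtype] at this
  -- The perfect group G' survives every further commutator.
  have hle : ∀ n, commutator G ≤ derivedSeries G n := by
    intro n
    induction n with
    | zero => simp
    | succ n ih =>
      rw [derivedSeries_succ, ← hperf]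
      exact Subgroup.commutator_mono ih ih
  have hmem : f x ∈ ⨅ n, derivedSeries N n := Subgroup.mem_iInf.2 fun n =>
    map_derivedSeries_le_derivedSeries f n (Subgroup.mem_map_of_mem f (hle n hx))
  rw [hN] at hmem
  exact hmem

end KnotTheory

namespace KnotTheory
open Set Topology

/-! ### Pulling back a tube along a partial diffeomorphism -/

section LocalDiffeomorph

variable {E F H₁ H₂ M N : Type*} [NormedAddCommGroup E] [NormedSpace ℝ E]
  [NormedAddCommGroup F] [NormedSpace ℝ F] [TopologicalSpace H₁] [TopologicalSpace H₂]
  {I : ModelWithCorners ℝ E H₁} {J : ModelWithCorners ℝ F H₂}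
  [TopologicalSpace M] [ChartedSpace H₁ M] [TopologicalSpace N] [ChartedSpace H₂ N]

/-- The inverse of an injective local diffeomorphism is a local diffeomorphism. -/
lemma isLocalDiffeomorphOn_invFunOn [Nonempty M] {f : M → N} {U : Set M} (hU : IsOpen U)
    (hf : IsLocalDiffeomorphOn I J ∞ f U) (hinj : InjOn f U) :
    IsLocalDiffeomorphOn J I ∞ (Function.invFunOn f U) (f '' U) := by
  rintro ⟨_, x, hx, rfl⟩
  obtain ⟨Φ, hxΦ, hΦ⟩ := hf ⟨x, hx⟩
  let e := Φ.toOpenPartialHomeomorph.restrOpen U hU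
  have hsrc : e.source = Φ.source ∩ U := rfl
  refine ⟨{ toPartialEquiv := e.symm.toPartialEquiv
            open_source := e.open_target
            open_target := e.open_source
            contMDiffOn_toFun := Φ.contMDiffOn_invFun.mono inter_subset_left
            contMDiffOn_invFun := Φ.contMDiffOn_toFun.mono inter_subset_left }, ?_, ?_⟩
  · change f x ∈ e.target
    rw [hΦ hxΦ]
    exact e.map_source ⟨hxΦ, hx⟩
  · intro y hy
    change y ∈ e.target at hy
    have h1 : e.symm y ∈ Φ.source ∩ U := e.map_target hy
    have h2 : f (e.symm y) = y := (hΦ h1.1).trans (e.right_inv hy)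
    change Function.invFunOn f U y = e.symm y
    conv_lhs => rw [← h2]
    exact hinj.leftInvOn_invFunOn h1.2

lemma isOpen_image_of_isLocalDiffeomorphOn {f : M → N} {U : Set M} (hU : IsOpen U)
    (hf : IsLocalDiffeomorphOn I J ∞ f U) : IsOpen (f '' U) := by
  rw [isOpen_iff_mem_nhds]
  rintro _ ⟨x, hx, rfl⟩
  rw [← hf.isLocalHomeomorphOn.map_nhds_eq hx]
  exact Filter.image_mem_map (hU.mem_nhds hx)

end LocalDiffeomorph

/-- The diffeomorphism `w ↦ ε w / √(1 + |w|²)` from the plane onto a disk, on each fibre. -/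
lemma isLocalDiffeomorph_prod_univBall (φ : Circle ≃ₘ⟮𝓡 1, 𝓡 1⟯ Circle) {ε : ℝ} (hε : 0 < ε) :
    IsLocalDiffeomorph ((𝓡 1).prod 𝓘(ℝ, ℂ)) ((𝓡 1).prod 𝓘(ℝ, ℂ)) ∞
      (fun p : Circle × ℂ => (φ p.1, OpenPartialHomeomorph.univBall (0 : ℂ) ε p.2)) := by
  intro x
  let e := φ.toHomeomorph.toOpenPartialHomeomorph.prod
    (OpenPartialHomeomorph.univBall (0 : ℂ) ε)
  have hsrc : e.source = univ := by simp [e]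
  have htgt : e.target = univ ×ˢ Metric.ball 0 ε := by
    simp [e, OpenPartialHomeomorph.univBall_target _ hε]
  refine ⟨{ toPartialEquiv := e.toPartialEquiv
            open_source := e.open_source
            open_target := e.open_target
            contMDiffOn_toFun := ?_
            contMDiffOn_invFun := ?_ }, ?_, fun y _ => rfl⟩
  · exact ((φ.contMDiff.comp contMDiff_fst).prodMk
      (OpenPartialHomeomorph.contDiff_univBall.contMDiff.comp contMDiff_snd)).contMDiffOn
  · rw [htgt]
    exact (φ.symm.contMDiff.comp contMDiff_fst).contMDiffOn.prodMk
      (OpenPartialHomeomorph.contDiffOn_univBall_symm.contMDiffOn.comp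
        contMDiff_snd.contMDiffOn fun p hp => hp.2)
  · change x ∈ e.source
    rw [hsrc]; trivial

lemma univBall_apply_of_norm_eq_one {ε : ℝ} (hε : 0 < ε) {w : ℂ} (hw : ‖w‖ = 1) :
    OpenPartialHomeomorph.univBall (0 : ℂ) ε w = ((ε * (√2)⁻¹ : ℝ) : ℂ) * w := by
  rw [OpenPartialHomeomorph.univBall, dif_pos hε]
  change ε • OpenPartialHomeomorph.univUnitBall w +ᵥ (0 : ℂ) = _
  rw [OpenPartialHomeomorph.univUnitBall_apply, hw]
  norm_num
  ring

namespace Knot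

variable {K L : Knot} {ι : S3 → S3} {U : Set S3}

/-- If a partial diffeomorphism takes the knot `K` to the knot `L`, then up to a reparametrization
it takes the parametrization of `K` to that of `L`. -/
lemma exists_reparametrization (hU : IsOpen U) (hι : IsLocalDiffeomorphOn (𝓡 3) (𝓡 3) ∞ ι U)
    (hinj : InjOn ι U) (hKU : K.image ⊆ U) (hL : L.image = ι '' K.image) :
    ∃ φ : Circle ≃ₘ⟮𝓡 1, 𝓡 1⟯ Circle, ∀ z, L.toFun (φ z) = ι (K.toFun z) := by
  have hKU' : ∀ z, K.toFun z ∈ U := fun z => hKU ⟨z, rfl⟩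
  have hinv := isLocalDiffeomorphOn_invFunOn hU hι hinj
  have hφ : ∀ z, ∃ z', L.toFun z' = ι (K.toFun z) := fun z =>
    hL.ge ⟨_, ⟨z, rfl⟩, rfl⟩
  have hψ : ∀ z, ∃ z', ι (K.toFun z') = L.toFun z := fun z => by
    obtain ⟨_, ⟨z', rfl⟩, h⟩ := hL.le ⟨z, rfl⟩
    exact ⟨z', h⟩
  choose φ hφ using hφ
  choose ψ hψ using hψ
  have hψ' : ∀ z, K.toFun (ψ z) = Function.invFunOn ι U (L.toFun z) := fun z => by
    rw [← hψ, hinj.leftInvOn_invFunOn (hKU' _)]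
  have hιK : ContMDiff (𝓡 1) (𝓡 3) ∞ (ι ∘ K.toFun) := fun z =>
    (hι ⟨_, hKU' z⟩).contMDiffAt.comp z (K.isSmoothEmbedding.contMDiff z)
  have hLι : ContMDiff (𝓡 1) (𝓡 3) ∞ (Function.invFunOn ι U ∘ L.toFun) := fun z =>
    (hinv ⟨L.toFun z, hψ z ▸ ⟨_, hKU' _, rfl⟩⟩).contMDiffAt.comp z
      (L.isSmoothEmbedding.contMDiff z)
  have eφ : L.toFun ∘ φ = ι ∘ K.toFun := funext hφ
  have eψ : K.toFun ∘ ψ = Function.invFunOn ι U ∘ L.toFun := funext hψ'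
  -- Smoothness can be tested after composing with the embedding `L.toFun`.
  have hφs : ContMDiff (𝓡 1) (𝓡 1) ∞ φ := by
    rw [ContMDiff.iff_comp_isImmersion L.isSmoothEmbedding.isImmersion,
      L.isSmoothEmbedding.isEmbedding.continuous_iff, eφ]
    exact ⟨hιK.continuous, hιK⟩
  have hψs : ContMDiff (𝓡 1) (𝓡 1) ∞ ψ := by
    rw [ContMDiff.iff_comp_isImmersion K.isSmoothEmbedding.isImmersion,
      K.isSmoothEmbedding.isEmbedding.continuous_iff, eψ]
    exact ⟨hLι.continuous, hLι⟩
  refine ⟨⟨⟨φ, ψ, fun z => ?_, fun z => ?_⟩, hφs, hψs⟩, hφ⟩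
  · apply K.isSmoothEmbedding.isEmbedding.injective
    rw [hψ', hφ, hinj.leftInvOn_invFunOn (hKU' _)]
  · apply L.isSmoothEmbedding.isEmbedding.injective
    rw [hφ, hψ]

/-- If a partial diffeomorphism takes the knot `K` to the knot `L`, then a tube of `L`, made thin
enough, is the image of a tube of `K`. -/
theorem IsTube.exists_pullback {τ : Circle × ℂ → S3} (hτ : L.IsTube τ) (hU : IsOpen U)
    (hι : IsLocalDiffeomorphOn (𝓡 3) (𝓡 3) ∞ ι U) (hinj : InjOn ι U) (hKU : K.image ⊆ U)
    (hL : L.image = ι '' K.image) :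
    ∃ τ', K.IsTube τ' ∧ range τ' ⊆ U ∧ ∃ z₀ : Circle, ∃ c : ℝ, 0 < c ∧
      ∀ w : Circle, ι (τ' (1, w)) = τ (z₀, c * w) := by
  obtain ⟨φ, hφ⟩ := exists_reparametrization hU hι hinj hKU hL
  have hinv := isLocalDiffeomorphOn_invFunOn hU hι hinj
  have hUo := isOpen_image_of_isLocalDiffeomorphOn hU hι
  -- By compactness of the circle, one radius `ε` serves all fibres; squeezing the tube to it allows
  -- `ι` to be inverted.
  obtain ⟨u, v, -, hv, hu, h0v, huv⟩ := generalized_tube_lemma (isCompact_univ (X := Circle))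
    (isCompact_singleton (x := (0 : ℂ))) (hUo.preimage hτ.continuous) (by
      rintro ⟨z, w⟩ ⟨-, rfl⟩
      rw [mem_preimage, hτ.core]
      exact image_mono hKU (hL.le ⟨z, rfl⟩))
  obtain ⟨ε, hε, hball⟩ := Metric.isOpen_iff.1 hv 0 (h0v rfl)
  let ρ := OpenPartialHomeomorph.univBall (0 : ℂ) ε
  have hρ : ∀ w, ρ w ∈ Metric.ball 0 ε := fun w => by
    rw [← OpenPartialHomeomorph.univBall_target _ hε]
    exact ρ.map_source (by simp [ρ])
  have hmem : ∀ p : Circle × ℂ, τ (φ p.1, ρ p.2) ∈ ι '' U := fun p =>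
    huv ⟨hu trivial, hball (hρ _)⟩
  let τ' : Circle × ℂ → S3 := fun p => Function.invFunOn ι U (τ (φ p.1, ρ p.2))
  have hτ' : ∀ p, ι (τ' p) = τ (φ p.1, ρ p.2) := fun p => Function.invFunOn_eq (hmem p)
  refine ⟨τ', ⟨fun z => ?_, fun p q hpq => ?_, fun p => ?_⟩, ?_, φ 1, ε * (√2)⁻¹, by positivity,
    fun w => ?_⟩
  · simp only [τ', ρ, OpenPartialHomeomorph.univBall_apply_zero, hτ.core, hφ]
    exact hinj.leftInvOn_invFunOn (hKU ⟨z, rfl⟩)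
  · have h := hτ.injective ((hτ' p).symm.trans ((congrArg ι hpq).trans (hτ' q)))
    obtain ⟨h1, h2⟩ := Prod.ext_iff.1 h
    exact Prod.ext (φ.injective h1) (ρ.injOn (by simp [ρ]) (by simp [ρ]) h2)
  · exact IsLocalDiffeomorphAt.comp (hg := hinv ⟨_, hmem p⟩)
      (hf := IsLocalDiffeomorphAt.comp (hg := hτ.isLocalDiffeomorph _)
        (hf := isLocalDiffeomorph_prod_univBall φ hε p))
  · rintro _ ⟨p, rfl⟩
    exact Function.invFunOn_mem (hmem p)
  · rw [hτ', univBall_apply_of_norm_eq_one hε w.norm_coe]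

end Knot
end KnotTheory

namespace KnotTheory
open Set Topology unitInterval

/-! ### Satellite knots -/

lemma Transport.toHom_surjective_of_toHom_surjective {X G : Type*} [TopologicalSpace X] [Group G]
    [PathConnectedSpace X] (F : Transport X G) {x : X} (h : Function.Surjective (F.toHom x))
    (y : X) : Function.Surjective (F.toHom y) := by
  intro g
  let p := PathConnectedSpace.somePath y x
  obtain ⟨γ, hγ⟩ := h (F p * g * (F p)⁻¹)
  induction γ using Quotient.ind with | _ γ =>
  refine ⟨FundamentalGroup.fromPath ⟦(p.trans γ).trans p.symm⟧, ?_⟩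
  rw [toHom_mk, F.trans, F.trans, F.symm, show F γ = _ from hγ]
  group

lemma isOpenEmbedding_restrict_of_isLocalDiffeomorphOn {f : S3 → S3} {U Z : Set S3} (hU : IsOpen U)
    (hZ : IsOpen Z) (hf : IsLocalDiffeomorphOn (𝓡 3) (𝓡 3) ∞ f U) (hinj : InjOn f U)
    (h : MapsTo f U Z) : IsOpenEmbedding (h.restrict f U Z) := by
  refine .of_comp _ hZ.isOpenEmbedding_subtypeVal ?_
  refine .of_continuous_injective_isOpenMap hf.contMDiffOn.continuousOn.domRestrict
    hinj.injective fun V hV => ?_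
  have : (Subtype.val ∘ h.restrict f U Z) '' V = f '' (Subtype.val '' V) := by
    rw [image_image]; rfl
  rw [this]
  exact isOpen_image_of_isLocalDiffeomorphOn (hU.isOpenMap_subtype_val V hV)
    fun x => hf ⟨x, by obtain ⟨_, y, -, rfl⟩ := x; exact y.2⟩

namespace Knot

/-! ### Meridian curves of a tube. -/

namespace IsTube

variable {K : Knot} {τ : Circle × ℂ → S3}

lemma homotopic (h : K.IsTube τ) {c d : C(Circle, K.Complement)}
    (hc : ∀ w : Circle, (c w : S3) = τ (1, w)) {z : Circle} {r : ℝ} (hr : 0 < r)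
    (hd : ∀ w : Circle, (d w : S3) = τ (z, r * w)) : d.Homotopic c := by
  have hpos : ∀ s : I, 0 < (1 - s) * r + (s : ℝ) := fun s => by
    rcases s.2.1.eq_or_lt with h | h
    · rw [← h]; simpa
    · nlinarith [s.2.2]
  refine ⟨⟨⟨fun p => ⟨τ (Circle.exp ((1 - p.1) * Complex.arg z),
    (((1 - p.1) * r + p.1 : ℝ) : ℂ) * p.2), fun hmem => ?_⟩, ?_⟩, fun w => ?_, fun w => ?_⟩⟩
  · have := (h.mem_image_iff _ _).1 hmem
    rw [mul_eq_zero, or_iff_left p.2.coe_ne_zero] at this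
    exact (hpos p.1).ne' (by exact_mod_cast this)
  · exact (h.continuous.comp (by fun_prop)).subtype_mk _
  · ext1; simp [hd, Circle.exp_arg]
  · ext1; simp [hc]

/-- A normal subgroup of a knot group which contains the meridian of a tube is the whole group. -/
theorem eq_top_of_meridian_mem (h : K.IsTube τ) {y : K.Complement} (hy : (y : S3) = τ (1, 1))
    (P : Subgroup (K.group y)) [P.Normal]
    (hP : ∀ p : Path y y, (∀ t : I, (p t : S3) = τ (1, Complex.exp (2 * Real.pi * t * Complex.I))) →
      (FundamentalGroup.fromPath ⟦p⟧ : K.group y) ∈ P) : P = ⊤ := by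
  have : PathConnectedSpace K.Complement :=
    isPathConnected_iff_pathConnectedSpace.1 h.isPathConnected_compl
  -- The projection to the quotient by `P` kills the meridian, so it extends over the knot to S³,
  -- where every transport is trivial on loops.
  obtain ⟨F, hF⟩ := Transport.exists_toHom_eq (QuotientGroup.mk' P)
  obtain ⟨F', hF'⟩ := F.exists_extension_of_meridian ⟨Subtype.val, continuous_subtype_val⟩
    K.isClosed_image.isOpen_compl.isOpenEmbedding_subtypeVal ⟨τ, h.continuous⟩ h.isOpenEmbedding
    (fun z w => by simpa using (h.mem_image_iff z w).not)
    (eq_univ_of_forall fun x => by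
      by_cases hx : x ∈ K.image
      · exact Or.inr (h.image_subset_range hx)
      · exact Or.inl ⟨⟨x, hx⟩, rfl⟩)
    (fun c hc => by
      have h0 : c 0 = y := Subtype.ext (by simpa [hy] using hc 0)
      have h1 : c 1 = y := Subtype.ext (by simpa [hy] using hc 1)
      have := hP ⟨c, h0, h1⟩ hc
      rw [← QuotientGroup.eq_one_iff] at this
      rw [← this]
      exact (F.toHom_mk ⟨c, h0, h1⟩).symm.trans (by rw [hF]; rfl))
  rw [eq_top_iff]
  intro g _
  induction g using Quotient.ind with | _ γ =>
  refine (QuotientGroup.eq_one_iff (FundamentalGroup.fromPath ⟦γ⟧ : K.group y)).1 ?_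
  have h1 : F γ = 1 := (hF' γ).symm.trans (F'.eq_one_of_sphere (γ.map continuous_subtype_val))
  have h2 := F.toHom_mk γ
  rw [hF, h1] at h2
  exact h2

end IsTube

/-- If the Alexander polynomial of `J` is trivial, then a transport on the complement of `J` with
values in a residually solvable group vanishes on the commutators of all fundamental groups. -/
lemma IsAlexanderPolynomial.toHom_eq_one {J : Knot} {j : J.Complement}
    (hJ : J.IsAlexanderPolynomial j 1) [PathConnectedSpace J.Complement] {G : Type*} [Group G]
    (hG : IsResiduallySolvable G) (F : Transport J.Complement G) (y : J.Complement)
    {x : J.group y} (hx : x ∈ commutator (J.group y)) : F.toHom y x = 1 := by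
  obtain ⟨m, -, hm⟩ := hJ
  rw [Ideal.span_singleton_one] at hm
  let e : J.group j ≃* J.group y := FundamentalGroup.fundamentalGroupMulEquivOfPathConnected j y
  have hmem : e.symm x ∈ commutator (J.group j) := by
    have := Subgroup.mem_map_of_mem e.symm.toMonoidHom hx
    rw [commutator_def, Subgroup.map_commutator] at this
    exact Subgroup.commutator_mono le_top le_top this
  have := map_eq_one_of_mem_commutator hG m hm ((F.toHom y).comp e.toMonoidHom) hmem
  simpa using this

/-- A transport on the complement of the satellite `K(α, J)`, with values in a residually solvable
group, is given by a transport on the complement of `K` if `J` has trivial Alexander polynomial. -/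
theorem IsSatellite.hasMeridionalEpi {K α J L T : Knot} (hL : IsSatellite K α J L)
    {k : K.Complement} {j : J.Complement} {t : T.Complement} {l : L.Complement}
    (hT : IsResiduallySolvable (T.group t)) (hJ : J.IsAlexanderPolynomial j 1)
    (h : HasMeridionalEpi L T l t) : HasMeridionalEpi K T k t := by
  obtain ⟨f, hf, m, hm, hfm⟩ := h
  obtain ⟨τ, ρ, hτ, hρ, hdisj, ι, κ, hι, hκ, hιi, hκi, hcov, hglue, hLim⟩ := hL
  have hKα : K.image ⊆ α.imageᶜ :=
    (hdisj.mono_right hτ.image_subset_range).subset_compl_right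
  have hαo : IsOpen α.imageᶜ := α.isClosed_image.isOpen_compl
  have hJo : IsOpen J.imageᶜ := J.isClosed_image.isOpen_compl
  have hKo : IsOpen K.imageᶜ := K.isClosed_image.isOpen_compl
  have hLo : IsOpen L.imageᶜ := L.isClosed_image.isOpen_compl
  -- The meridian `m` comes with a tube of `L`.
  have hLc : PathConnectedSpace L.Complement := by
    obtain ⟨τ, hτ, -⟩ := hm
    exact isPathConnected_iff_pathConnectedSpace.1 hτ.isPathConnected_compl
  have hJc : PathConnectedSpace J.Complement :=
    isPathConnected_iff_pathConnectedSpace.1 hρ.isPathConnected_compl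
  obtain ⟨F, rfl⟩ := Transport.exists_toHom_eq f
  obtain ⟨τL, hτL, cL, hcL, hconj⟩ := hm.exists_isConj F
  obtain ⟨τK, hτK, hτKα, z₀, r, hr, hτKL⟩ := hτL.exists_pullback hαo hι hιi hKα hLim
  have hKc : PathConnectedSpace K.Complement :=
    isPathConnected_iff_pathConnectedSpace.1 hτK.isPathConnected_compl
  have hτK' : range τ ⊆ K.imageᶜ := hdisj.symm.subset_compl_right
  let W : Set S3 := K.imageᶜ \ α.image
  have hWo : IsOpen W := hKo.sdiff α.isClosed_image
  have hWα : W ⊆ α.imageᶜ := fun x hx => hx.2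
  have hWc : PathConnectedSpace W := isPathConnected_iff_pathConnectedSpace.1
    (hτ.isPathConnected_diff hτK.isPathConnected_compl hτK')
  -- the maps between the complements
  have hιW : MapsTo ι W L.imageᶜ := fun x hx hxL => by
    rw [hLim] at hxL
    obtain ⟨y, hy, hyx⟩ := hxL
    exact hx.1 (hιi (hKα hy) hx.2 hyx ▸ hy)
  have hκJ : MapsTo κ J.imageᶜ L.imageᶜ := fun q hq hqL => by
    rw [hLim] at hqL
    obtain ⟨y, hy, hyq⟩ := hqL
    obtain ⟨z, w, s, -, h, -⟩ := (hglue y (hKα hy) q hq).1 hyq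
    exact disjoint_left.1 hdisj hy ⟨_, h.symm⟩
  have hιe := isOpenEmbedding_restrict_of_isLocalDiffeomorphOn hWo hLo
    (fun x => hι ⟨x, hWα x.2⟩) (hιi.mono hWα) hιW
  have hκe := isOpenEmbedding_restrict_of_isLocalDiffeomorphOn hJo hLo hκ hκi hκJ
  let ι' : C(W, L.Complement) := ⟨_, hιe.continuous⟩
  let κ' : C(J.Complement, L.Complement) := ⟨_, hκe.continuous⟩
  have hτW : ∀ z w, w ≠ 0 → τ (z, w) ∈ W := fun z w hw =>
    ⟨hτK' ⟨_, rfl⟩, (hτ.mem_image_iff z w).not.2 hw⟩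
  have hρJ : ∀ z w, w ≠ 0 → ρ (z, w) ∈ J.imageᶜ := fun z w hw => (hρ.mem_image_iff z w).not.2 hw
  have hglue' : ∀ z w : Circle, ι (τ (z, w)) = κ (ρ (w, z)) := fun z w =>
    (hglue _ (hτW z w w.coe_ne_zero).2 _ (hρJ w z z.coe_ne_zero)).2
      ⟨z, w, 1, one_pos, by simp, by simp⟩
  -- the transport on the complement of `J` vanishes on the longitude
  have hcomm : ∀ (y : J.Complement) {x : J.group y}, x ∈ commutator (J.group y) →
      (F.comap κ').toHom y x = 1 := fun y _ hx => hJ.toHom_eq_one hT (F.comap κ') y hx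
  obtain ⟨F', hF'⟩ := (F.comap ι').exists_extension_of_meridian
    ⟨inclusion fun x hx => hx.1, continuous_inclusion _⟩ (by
      refine .of_comp _ hKo.isOpenEmbedding_subtypeVal ?_
      exact hWo.isOpenEmbedding_subtypeVal)
    ⟨fun p => ⟨τ p, hτK' ⟨p, rfl⟩⟩, hτ.continuous.subtype_mk _⟩ (by
      refine .of_comp _ hKo.isOpenEmbedding_subtypeVal ?_
      exact hτ.isOpenEmbedding)
    (fun z w => by
      rw [ne_eq, ← hτ.mem_image_iff z w]
      constructor
      · rintro ⟨x, hx⟩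
        have : (x : S3) = τ (z, w) := congrArg Subtype.val hx
        exact this ▸ x.2.2
      · exact fun h => ⟨⟨τ (z, w), hτK' ⟨_, rfl⟩, h⟩, rfl⟩)
    (eq_univ_of_forall fun x => by
      by_cases hx : (x : S3) ∈ α.image
      · obtain ⟨p, hp⟩ := hτ.image_subset_range hx
        exact Or.inr ⟨p, Subtype.ext hp⟩
      · exact Or.inl ⟨⟨x, x.2, hx⟩, rfl⟩)
    -- The gluing takes the meridian of `α` to the zero-linking longitude of `J`, a product of
    -- commutators.
    (fun c hc => by
      obtain ⟨cJ, hcJ, hmem⟩ := hρ.longitude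
      have := hcomm _ hmem
      rw [Transport.toHom_mk] at this
      rw [← this]
      change F _ = F _
      congr 1
      ext1 s
      refine Subtype.ext ?_
      have h1 : (c s : S3) = τ (1, Circle.exp (2 * Real.pi * s)) := by
        refine (congrArg Subtype.val (hc s)).trans ?_
        simp [Circle.coe_exp]
      change ι (c s) = κ (cJ (Circle.exp (2 * Real.pi * s)))
      rw [h1, hcJ, hglue']
      rfl)
  refine ⟨F'.toHom k, ?_, ?_⟩
  · let a₀ : W := ⟨τ (1, 1), hτW 1 1 one_ne_zero⟩
    let q₀ : J.Complement := ⟨ρ (1, 1), hρJ 1 1 one_ne_zero⟩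
    have hx₀ : ι' a₀ = κ' q₀ := Subtype.ext (hglue' 1 1)
    let H : Subgroup (T.group t) := ((F.comap ι').toHom a₀).range
    have hABc : IsPathConnected (range ι' ∩ range κ') := by
      have : range ι' ∩ range κ' = ι' '' (Subtype.val ⁻¹' (range τ \ α.image)) := by
        ext x
        constructor
        · rintro ⟨⟨a, rfl⟩, q, hq⟩
          obtain ⟨z, w, s, -, h, -⟩ :=
            (hglue a a.2.2 q q.2).1 (congrArg Subtype.val hq).symm
          exact ⟨a, ⟨⟨_, h.symm⟩, a.2.2⟩, rfl⟩
        · rintro ⟨a, ⟨⟨⟨z, w⟩, hzw⟩, ha⟩, rfl⟩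
          rw [← hzw, hτ.mem_image_iff] at ha
          let w' := Circle.exp (Complex.arg w)
          have hw' : ((‖w‖⁻¹ : ℝ) : ℂ) * z ≠ 0 :=
            mul_ne_zero (by exact_mod_cast inv_ne_zero (norm_ne_zero_iff.2 ha)) z.coe_ne_zero
          refine ⟨⟨a, rfl⟩, ⟨ρ (w', ((‖w‖⁻¹ : ℝ) : ℂ) * z), hρJ _ _ hw'⟩, Subtype.ext ?_⟩
          refine ((hglue a a.2.2 _ (hρJ _ _ hw')).2
            ⟨z, w', ‖w‖, norm_pos_iff.2 ha, ?_, rfl⟩).symm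
          rw [← hzw, Circle.coe_exp, Complex.norm_mul_exp_arg_mul_I]
      rw [this]
      refine IsPathConnected.image (hτ.isPathConnected_range_diff.preimage_coe ?_) ι'.continuous
      exact fun x hx => ⟨hτK' hx.1, hx.2⟩
    have hcover : range ι' ∪ range κ' = univ := by
      refine eq_univ_of_forall fun x => ?_
      obtain ⟨a, ha, hax⟩ | ⟨q, hq, hqx⟩ := hcov.symm ▸ mem_univ (x : S3)
      · exact Or.inl ⟨⟨a, fun haK => x.2 (hLim.ge ⟨a, haK, hax⟩), ha⟩, Subtype.ext hax⟩
      · exact Or.inr ⟨⟨q, hq⟩, Subtype.ext hqx⟩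
    have hA : ∀ γ : Path (ι' a₀) (ι' a₀), (∀ s, γ s ∈ range ι') → F γ ∈ H := fun γ hγ => by
      obtain ⟨c, hc⟩ := exists_comp_eq hιe.isEmbedding (i := ι') γ.toContinuousMap hγ
      have h0 : c 0 = a₀ := hιe.injective ((DFunLike.congr_fun hc 0).trans γ.source)
      have h1 : c 1 = a₀ := hιe.injective ((DFunLike.congr_fun hc 1).trans γ.target)
      exact ⟨FundamentalGroup.fromPath ⟦⟨c, h0, h1⟩⟧,
        ((F.comap ι').toHom_mk _).trans (congrArg F.toFun hc)⟩
    have hB : ∀ γ : Path (ι' a₀) (ι' a₀), (∀ s, γ s ∈ range κ') → F γ ∈ H := fun γ hγ => by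
      obtain ⟨c, hc⟩ := exists_comp_eq hκe.isEmbedding (i := κ') γ.toContinuousMap hγ
      have h0 : c 0 = q₀ := hκe.injective ((DFunLike.congr_fun hc 0).trans (γ.source.trans hx₀))
      have h1 : c 1 = q₀ := hκe.injective ((DFunLike.congr_fun hc 1).trans (γ.target.trans hx₀))
      -- `H` is not known to be normal, but `P` is, as it contains the commutators, which are
      -- killed. It contains the meridian of `J` because that is glued to the longitude of `α`.
      let P := H.comap ((F.comap κ').toHom q₀)
      have : P.Normal := .of_commutator_le (J.group q₀) fun x hx => by
        rw [Subgroup.mem_comap, hcomm q₀ hx]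
        exact H.one_mem
      have hP : P = ⊤ := hρ.eq_top_of_meridian_mem (y := q₀) rfl P fun p hp => by
        rw [Subgroup.mem_comap, Transport.toHom_mk]
        refine hA ((p.map κ'.continuous).cast hx₀ hx₀) fun s => ?_
        refine ⟨⟨τ (Circle.exp (2 * Real.pi * s), 1), hτW _ _ one_ne_zero⟩, Subtype.ext ?_⟩
        change ι (τ (_, 1)) = κ (p s)
        rw [hp, ← Circle.coe_one, hglue']
        simp [Circle.coe_exp]
      have := hP ▸ Subgroup.mem_top (FundamentalGroup.fromPath ⟦⟨c, h0, h1⟩⟧ : J.group q₀)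
      rw [Subgroup.mem_comap, Transport.toHom_mk] at this
      exact (congrArg F.toFun hc) ▸ this
    have hmem := map_mem_of_open_cover (f := F.toHom (ι' a₀)) (H := H) hιe.isOpen_range
      hκe.isOpen_range hcover (isPathConnected_range ι'.continuous)
      (isPathConnected_range κ'.continuous) hABc ⟨⟨a₀, rfl⟩, q₀, hx₀.symm⟩ hA hB
    have hsurj : Function.Surjective ((F.comap ι').toHom a₀) := fun g => by
      obtain ⟨x, rfl⟩ := F.toHom_surjective_of_toHom_surjective hf (ι' a₀) g
      exact hmem x
    refine F'.toHom_surjective_of_toHom_surjective (x := inclusion (fun x hx => hx.1) a₀)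
      (fun g => ?_) k
    obtain ⟨γ, rfl⟩ := hsurj g
    induction γ using Quotient.ind with | _ γ =>
    refine ⟨FundamentalGroup.fromPath ⟦γ.map (continuous_inclusion fun x hx => hx.1)⟧, ?_⟩
    exact hF' γ
  · let cW : C(Circle, W) := ⟨fun w => ⟨τK (1, w),
      (hτK.mem_image_iff _ _).not.2 w.coe_ne_zero, hτKα ⟨_, rfl⟩⟩,
      (hτK.continuous.comp (by fun_prop)).subtype_mk _⟩
    let cK : C(Circle, K.Complement) :=
      (⟨inclusion fun x hx => hx.1, continuous_inclusion _⟩ : C(W, K.Complement)).comp cW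
    obtain ⟨m', hm', hconj'⟩ := hτK.exists_isMeridian (c := cK) (fun w => rfl)
      (PathConnectedSpace.somePath k _) F'
    have h1 : F' (circleLoop cK) = F (circleLoop (ι'.comp cW)) := hF' (circleLoop cW)
    rw [h1] at hconj'
    -- The conjugacies lead from `m` to the meridian curve of `τL`, to the `ι`-image of that of
    -- `τK`, and to `m'`.
    obtain ⟨g, hg⟩ := isConj_iff.1 ((hconj.trans (F.isConj_of_homotopic
      (hτL.homotopic hcL hr fun w => hτKL w)).symm).trans hconj')
    exact ⟨m', hm', hg ▸ hfm.conj g⟩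

end Knot
end KnotTheory

end

theorem mainTheorem4 (K α J T L : KnotTheory.Knot)
    (hα : α.IsUnknotted) (hKα : Disjoint K.image α.image)
    (hL : KnotTheory.Knot.IsSatellite K α J L)
    (k : K.Complement) (j : J.Complement) (t : T.Complement) (l : L.Complement)
    (hT : KnotTheory.IsResiduallySolvable (T.group t))
    (hJ : J.IsAlexanderPolynomial j 1)
    (hK : ¬ KnotTheory.Knot.HasMeridionalEpi K T k t) :
    ¬ KnotTheory.Knot.HasMeridionalEpi L T l t :=
  fun h => hK (hL.hasMeridionalEpi hT hJ h)
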